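/- Let $n\ge 1$ and let $B_n$ be the braid group with generators $\sigma_1,\dots,\sigma_{n-1}$ and relations $\sigma_i\sigma_j=\sigma_j\sigma_i$ for $|i-j|\ge 2$, $\sigma_i\sigma_{i+1}\sigma_i=\sigma_{i+1}\sigma_i\sigma_{i+1}$ for $1\le i\le n-2$. Let $q\in\mathbf R$ with $0<q<1$, let $R=\mathbf R[t^{\pm1}]$, let $\mathrm{Ref}=\{(i,j)\mid 1\le i<j\le n\}$, and let $V$ be the free $R$-module with basis $\{x_{i,j}\}_{(i,j)\in\mathrm{Ref}}$. Let $B_n$ act $R$-linearly on $V$ by Krammer's representation $$\sigma_k(x_{i,j})=\begin{cases} x_{i,j} & k<i-1 \text{ or } j<k,\\ x_{i-1,j}+(1-q)x_{i,j} & k=i-1,\\ tq(q-1)x_{i,i+1}+q\,x_{i+1,j} & k=i<j-1,\\ tq^2x_{i,j} & k=i=j-1,\\ x_{i,j}+tq^{k-i}(q-1)^2x_{k,k+1} & i<k<j-1,\\ x_{i,j-1}+tq^{j-i}(q-1)x_{j-1,j} & i<k=j-1,\\ (1-q)x_{i,j}+q\,x_{i,j+1} & k=j.\end{cases}$$ For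 a permutation $w\in S_n$ let $|w|$ be its length with respect to the simple transpositions $s_k=(k,k+1)$, and let $r(w)\in B_n$ be the braid $\sigma_{k_1}\cdots\sigma_{k_m}$ for any expression $w=s_{k_1}\cdots s_{k_m}$ with $m=|w|$. Put $\Omega=r(S_n)$, and let $B_n^+$ be the submonoid of $B_n$ generated by $\sigma_1,\dots,\sigma_{n-1}$. For $b\in B_n^+$ let $LF(b)=r(w)$, where $w$ is the longest element of $S_n$ with $b\in r(w)B_n^+$. For $w\in S_n$ put $L(w)=\{(i,j)\in\mathrm{Ref}\mid w^{-1}(i)>w^{-1}(j)\}$. A half-permutation is a set $A\subset\mathrm{Ref}$ such that $(i,j),(j,k)\in A$ implies $(i,k)\in A$. For a half-permutation $A$ let $GB(A)=r(w)$, where $L(w)$ is the greatest subset of $A$ (with respect to inclusion) of the form $L(w)$, $w\in S_n$. For $A\subset \mathrm{Ref}$ let $W_A\subset V$ be the set of vectors $\sum_{s\in\mathrm{Ref}} k_sx_s$ with all $k_s\in\mathbf R_{\ge0}+t\mathbf R[t]$ and such that $k_s\in t\mathbf R[t]$ if and only if $s\in A$. For $x\in\Omega$ let $C_x=\bigcup_A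 W_A$, where $A$ runs over all half-permutations with $GB(A)=x$. Then the sets $C_x$ ($x\in\Omega$) are non-empty and pairwise disjoint, and $x\,C_y\subset C_{LF(xy)}$ for all $x,y\in\Omega$. Moreover, the action of $B_n$ on $V$ is faithful. -/

import Mathlib

namespace Krammer

/-- Artin's relators on generators indexed by `0, …, n - 2` (the generator `σ_{k+1}` of the
literature has index `k` here): far commutation and the braid relation. -/
def braidRels (n : ℕ) : Set (FreeGroup (Fin (n - 1))) :=
  {w | ∃ i j : Fin (n - 1), (i : ℕ) + 2 ≤ j ∧
      w = (FreeGroup.of i * FreeGroup.of j) * (FreeGroup.of j * FreeGroup.of i)⁻¹} ∪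
  {w | ∃ i j : Fin (n - 1), (i : ℕ) + 1 = j ∧
      w = (FreeGroup.of i * FreeGroup.of j * FreeGroup.of i) *
        (FreeGroup.of j * FreeGroup.of i * FreeGroup.of j)⁻¹}

/-- The braid group on `n` strings, by Artin's presentation. -/
abbrev BraidGroup (n : ℕ) : Type := PresentedGroup (braidRels n)

/-- The standard generators of the braid group. -/
def sigma {n : ℕ} (k : Fin (n - 1)) : BraidGroup n := PresentedGroup.of k

/-- Pairs `(i, j)` with `i < j` in `{0, …, n - 1}` (instead of `{1, …, n}`). -/
abbrev Ref (n : ℕ) : Type := {s : Fin n × Fin n // s.1 < s.2}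

/-- The free `R`-module with basis indexed by the pairs `i < j`. -/
abbrev V (n : ℕ) (R : Type*) [CommRing R] : Type _ := Ref n →₀ R

section Representation

variable {n : ℕ} {R : Type*} [CommRing R]

/-- The basis vector `x_{i,j}` for `i < j < n`. The value `0` on other pairs is never used. -/
noncomputable def xvec (n : ℕ) (R : Type*) [CommRing R] (i j : ℕ) : V n R :=
  if h : i < j ∧ j < n then
    Finsupp.single ⟨(⟨i, h.1.trans h.2⟩, ⟨j, h.2⟩), Fin.mk_lt_mk.mpr h.1⟩ 1
  else 0

/-- The vector `σ_k (x_{i,j})` in Krammer's representation. The seven cases cover everything for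
`i < j`; indices start at `0`, and the formula depends only on differences of indices. In the last
two cases `i < k` holds, and in the last case `k = j`. -/
noncomputable def sigmaValue (n : ℕ) {R : Type*} [CommRing R] (q t : R) (k i j : ℕ) : V n R :=
  if k + 1 < i ∨ j < k then xvec n R i j
  else if k + 1 = i then xvec n R (i - 1) j + (1 - q) • xvec n R i j
  else if k = i ∧ k + 1 < j then
    (t * q * (q - 1)) • xvec n R i (i + 1) + q • xvec n R (i + 1) j
  else if k = i ∧ k + 1 = j then (t * q ^ 2) • xvec n R i j
  else if i < k ∧ k + 1 < j then
    xvec n R i j + (t * q ^ (k - i) * (q - 1) ^ 2) • xvec n R k (k + 1)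
  else if k + 1 = j then
    xvec n R i (j - 1) + (t * q ^ (j - i) * (q - 1)) • xvec n R (j - 1) j
  else (1 - q) • xvec n R i j + q • xvec n R i (j + 1)

/-- The `R`-linear endomorphism of `V` by which `σ_k` acts. -/
noncomputable def sigmaMap (n : ℕ) {R : Type*} [CommRing R] (q t : R) (k : ℕ) :
    V n R →ₗ[R] V n R :=
  Finsupp.linearCombination R fun s : Ref n => sigmaValue n q t k s.1.1 s.1.2

theorem sigmaMap_xvec (q t : R) {k i j : ℕ} (hij : i < j) (hj : j < n) :
    sigmaMap n q t k (xvec n R i j) = sigmaValue n q t k i j := by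
  simp [sigmaMap, xvec, hij, hj]

theorem single_eq_xvec (s : Ref n) (c : R) :
    Finsupp.single s c = c • xvec n R s.1.1 s.1.2 := by
  have h : ((s.1.1 : ℕ) < s.1.2) ∧ (s.1.2 : ℕ) < n := ⟨s.2, s.1.2.2⟩
  simp only [xvec, dif_pos h, Finsupp.smul_single, smul_eq_mul, mul_one]

theorem linearMap_ext {f g : V n R →ₗ[R] V n R}
    (h : ∀ i j, i < j → j < n → f (xvec n R i j) = g (xvec n R i j)) : f = g := by
  refine Finsupp.lhom_ext fun s c => ?_
  rw [single_eq_xvec, map_smul, map_smul, h _ _ s.2 s.1.2.2]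

theorem sm_far_right (q t : R) {k i j : ℕ} (hij : i < j) (hj : j < n) (h : k + 1 < i) :
    sigmaMap n q t k (xvec n R i j) = xvec n R i j := by
  rw [sigmaMap_xvec q t hij hj, sigmaValue, if_pos (Or.inl h)]

theorem sm_far_left (q t : R) {k i j : ℕ} (hij : i < j) (hj : j < n) (h : j < k) :
    sigmaMap n q t k (xvec n R i j) = xvec n R i j := by
  rw [sigmaMap_xvec q t hij hj, sigmaValue, if_pos (Or.inr h)]

theorem sm_left_succ (q t : R) {k j : ℕ} (hij : k + 1 < j) (hj : j < n) :
    sigmaMap n q t k (xvec n R (k + 1) j)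
      = xvec n R k j + (1 - q) • xvec n R (k + 1) j := by
  rw [sigmaMap_xvec q t hij hj, sigmaValue, if_neg (by omega), if_pos rfl, Nat.add_sub_cancel]

theorem sm_left (q t : R) {k j : ℕ} (hij : k + 1 < j) (hj : j < n) :
    sigmaMap n q t k (xvec n R k j)
      = (t * q * (q - 1)) • xvec n R k (k + 1) + q • xvec n R (k + 1) j := by
  rw [sigmaMap_xvec q t (by omega) hj, sigmaValue, if_neg (by omega), if_neg (by omega),
    if_pos ⟨rfl, hij⟩]

theorem sm_self (q t : R) {k : ℕ} (hj : k + 1 < n) :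
    sigmaMap n q t k (xvec n R k (k + 1)) = (t * q ^ 2) • xvec n R k (k + 1) := by
  rw [sigmaMap_xvec q t (by omega) hj, sigmaValue, if_neg (by omega), if_neg (by omega),
    if_neg (by omega), if_pos ⟨rfl, rfl⟩]

theorem sm_mid (q t : R) {k i j : ℕ} (hj : j < n) (h1 : i < k) (h2 : k + 1 < j) :
    sigmaMap n q t k (xvec n R i j)
      = xvec n R i j + (t * q ^ (k - i) * (q - 1) ^ 2) • xvec n R k (k + 1) := by
  rw [sigmaMap_xvec q t (by omega) hj, sigmaValue, if_neg (by omega), if_neg (by omega),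
    if_neg (by omega), if_neg (by omega), if_pos ⟨h1, h2⟩]

theorem sm_right_succ (q t : R) {k i : ℕ} (hj : k + 1 < n) (h1 : i < k) :
    sigmaMap n q t k (xvec n R i (k + 1))
      = xvec n R i k + (t * q ^ (k + 1 - i) * (q - 1)) • xvec n R k (k + 1) := by
  rw [sigmaMap_xvec q t (by omega) hj, sigmaValue, if_neg (by omega), if_neg (by omega),
    if_neg (by omega), if_neg (by omega), if_neg (by omega), if_pos rfl, Nat.add_sub_cancel]

theorem sm_right (q t : R) {k i : ℕ} (hj : k < n) (h1 : i < k) :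
    sigmaMap n q t k (xvec n R i k)
      = (1 - q) • xvec n R i k + q • xvec n R i (k + 1) := by
  rw [sigmaMap_xvec q t h1 hj, sigmaValue, if_neg (by omega), if_neg (by omega),
    if_neg (by omega), if_neg (by omega), if_neg (by omega), if_neg (by omega)]

theorem sigmaMap_surjective (q t : Rˣ) {k : ℕ} (hk : k + 1 < n) :
    Function.Surjective (sigmaMap n (q : R) (t : R) k) := by
  rw [← LinearMap.range_eq_top, eq_top_iff]
  set S := LinearMap.range (sigmaMap n (q : R) (t : R) k) with hS
  have hu : ∀ (u : Rˣ) (v : V n R), (u : R) • v ∈ S → v ∈ S := by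
    intro u v h
    have := S.smul_mem ((u⁻¹ : Rˣ) : R) h
    rwa [smul_smul, Units.inv_mul, one_smul] at this
  have hm : ∀ v, sigmaMap n (q : R) (t : R) k v ∈ S := fun v => ⟨v, rfl⟩
  have hself : xvec n R k (k + 1) ∈ S := by
    apply hu (t * q ^ 2)
    simpa [sm_self _ _ hk] using hm (xvec n R k (k + 1))
  have hmain : ∀ i j, i < j → j < n → xvec n R i j ∈ S := by
    intro i j hij hj
    have hleft : ∀ j, k + 1 < j → j < n → xvec n R (k + 1) j ∈ S := by
      intro j h1 h2
      have h := hm (xvec n R k j)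
      rw [sm_left _ _ h1 h2] at h
      exact hu q _ ((Submodule.add_mem_iff_right _ (S.smul_mem _ hself)).mp h)
    have hright : ∀ i, i < k → xvec n R i k ∈ S := by
      intro i h1
      have h := hm (xvec n R i (k + 1))
      rw [sm_right_succ _ _ hk h1] at h
      exact (Submodule.add_mem_iff_left _ (S.smul_mem _ hself)).mp h
    rcases lt_or_ge (k + 1) i with h1 | h1
    · have h := hm (xvec n R i j)
      rwa [sm_far_right _ _ hij hj h1] at h
    rcases lt_or_ge j k with h2 | h2
    · have h := hm (xvec n R i j)
      rwa [sm_far_left _ _ hij hj h2] at h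
    rcases Nat.eq_or_lt_of_le h1 with rfl | h1
    · exact hleft j hij hj
    rcases Nat.eq_or_lt_of_le h2 with rfl | h2
    · exact hright i hij
    rcases Nat.eq_or_lt_of_le h2 with rfl | h2
    · rcases Nat.eq_or_lt_of_le (Nat.lt_succ_iff.mp h1) with rfl | h1
      · exact hself
      · have h := hm (xvec n R i k)
        rw [sm_right _ _ (by omega) h1] at h
        exact hu q _ ((Submodule.add_mem_iff_right _ (S.smul_mem _ (hright i h1))).mp h)
    rcases Nat.eq_or_lt_of_le (Nat.lt_succ_iff.mp h1) with rfl | h1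
    · have h := hm (xvec n R (i + 1) j)
      rw [sm_left_succ _ _ h2 hj] at h
      exact (Submodule.add_mem_iff_left _ (S.smul_mem _ (hleft j h2 hj))).mp h
    · have h := hm (xvec n R i j)
      rw [sm_mid _ _ hj h1 h2] at h
      exact (Submodule.add_mem_iff_left _ (S.smul_mem _ hself)).mp h
  intro v _
  induction v using Finsupp.induction_linear with
  | zero => exact S.zero_mem
  | add f g hf hg => exact S.add_mem (hf trivial) (hg trivial)
  | single s c =>
    rw [single_eq_xvec]
    exact S.smul_mem _ (hmain _ _ s.2 s.1.2.2)

/-- `σ_k` acts invertibly when `q` and `t` are units. -/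
noncomputable def sigmaEquiv (q t : Rˣ) (k : Fin (n - 1)) : V n R ≃ₗ[R] V n R :=
  have hs := sigmaMap_surjective (n := n) q t (k := k) (by omega)
  LinearEquiv.ofBijective (sigmaMap n (q : R) (t : R) k)
    ⟨OrzechProperty.injective_of_surjective_endomorphism _ hs, hs⟩

theorem sigmaMap_braid (q t : R) {k : ℕ} (hk : k + 1 + 1 < n) (v : V n R) :
    sigmaMap n q t k (sigmaMap n q t (k + 1) (sigmaMap n q t k v)) =
      sigmaMap n q t (k + 1) (sigmaMap n q t k (sigmaMap n q t (k + 1) v)) := by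
  suffices h : sigmaMap n q t k ∘ₗ sigmaMap n q t (k + 1) ∘ₗ sigmaMap n q t k =
      sigmaMap n q t (k + 1) ∘ₗ sigmaMap n q t k ∘ₗ sigmaMap n q t (k + 1) from
    LinearMap.congr_fun h v
  refine linearMap_ext fun i j hij hj => ?_
  simp only [LinearMap.comp_apply]
  have e0 (a : ℕ) : a + 1 + 1 - a = 2 := by omega
  have ci : i < k ∨ i = k ∨ i = k + 1 ∨ i = k + 1 + 1 ∨ k + 1 + 1 < i := by omega
  have cj : j < k ∨ j = k ∨ j = k + 1 ∨ j = k + 1 + 1 ∨ k + 1 + 1 < j := by omega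
  rcases ci with h | rfl | rfl | rfl | h <;> rcases cj with h' | rfl | rfl | rfl | h' <;>
    first
    | (exfalso; omega)
    | (try have e1 : k + 1 - i = (k - i) + 1 := by omega
       try have e2 : k + 1 + 1 - i = (k - i) + 2 := by omega
       try have e3 : j + 1 - i = (j - i) + 1 := by omega
       try have e4 : j + 1 + 1 - i = (j - i) + 2 := by omega
       simp (disch := omega) only [sm_far_right, sm_far_left, sm_left_succ, sm_left, sm_self,
         sm_mid, sm_right_succ, sm_right, map_add, map_smul, *, add_tsub_cancel_left]
       try module)

theorem sigmaMap_comm (q t : R) {k l : ℕ} (hkl : k + 2 ≤ l) (hl : l + 1 < n) (v : V n R) :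
    sigmaMap n q t k (sigmaMap n q t l v) = sigmaMap n q t l (sigmaMap n q t k v) := by
  suffices h : sigmaMap n q t k ∘ₗ sigmaMap n q t l =
      sigmaMap n q t l ∘ₗ sigmaMap n q t k from LinearMap.congr_fun h v
  refine linearMap_ext fun i j hij hj => ?_
  simp only [LinearMap.comp_apply]
  have e1 (a : ℕ) (h : a + 2 ≤ l) : l - a = (l - (a + 1)) + 1 := by omega
  have e2 (a : ℕ) (h : a + 2 ≤ l) : l + 1 - a = (l - (a + 1)) + 2 := by omega
  have e3 (a : ℕ) (h : a + 2 ≤ l) : l + 1 - (a + 1) = (l - (a + 1)) + 1 := by omega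
  have ci : i < k ∨ i = k ∨ i = k + 1 ∨ (k + 1 < i ∧ i < l) ∨ i = l ∨ i = l + 1 ∨ l + 1 < i := by
    omega
  have cj : j < k ∨ j = k ∨ j = k + 1 ∨ (k + 1 < j ∧ j < l) ∨ j = l ∨ j = l + 1 ∨ l + 1 < j := by
    omega
  rcases ci with h | rfl | rfl | ⟨h, h2⟩ | rfl | rfl | h <;>
    rcases cj with h' | rfl | rfl | ⟨h', h2'⟩ | rfl | rfl | h' <;>
    first
    | (exfalso; omega)
    | (simp (disch := omega) only [sm_far_right, sm_far_left, sm_left_succ, sm_left, sm_self,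
         sm_mid, sm_right_succ, sm_right, map_add, map_smul]
       try simp only [e1 _ hkl, e2 _ hkl, e3 _ hkl]
       try module)
theorem sigmaEquiv_apply (q t : Rˣ) (k : Fin (n - 1)) (v : V n R) :
    sigmaEquiv q t k v = sigmaMap n (q : R) (t : R) k v := rfl

theorem sigmaEquiv_rels (q t : Rˣ) :
    ∀ r ∈ braidRels n, FreeGroup.lift (sigmaEquiv (n := n) q t) r = 1 := by
  rintro r (⟨i, j, hij, rfl⟩ | ⟨i, j, hij, rfl⟩)
  · rw [map_mul, map_inv, mul_inv_eq_one]
    ext1 v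
    simp only [map_mul, FreeGroup.lift_apply_of, LinearEquiv.mul_apply, sigmaEquiv_apply]
    exact sigmaMap_comm _ _ hij (by omega) v
  · rw [map_mul, map_inv, mul_inv_eq_one]
    ext1 v
    simp only [map_mul, FreeGroup.lift_apply_of, LinearEquiv.mul_apply, sigmaEquiv_apply, ← hij]
    exact sigmaMap_braid _ _ (by omega) v

/-- Krammer's representation of the braid group over a commutative ring with units `q`, `t`. -/
noncomputable def krammerRep (n : ℕ) {R : Type*} [CommRing R] (q t : Rˣ) :
    BraidGroup n →* (V n R ≃ₗ[R] V n R) :=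
  PresentedGroup.toGroup (sigmaEquiv_rels (n := n) q t)

/-- The generators act by the prescribed formulas. -/
theorem krammerRep_sigma_xvec (q t : Rˣ) (k : Fin (n - 1)) {i j : ℕ} (hij : i < j) (hj : j < n) :
    krammerRep n q t (sigma k) (xvec n R i j) = sigmaValue n (q : R) (t : R) k i j := by
  rw [krammerRep, sigma, PresentedGroup.toGroup.of, sigmaEquiv_apply, sigmaMap_xvec _ _ hij hj]

end Representation

/-- The simple transposition exchanging `k` and `k + 1`. -/
def simpleSwap {n : ℕ} (k : Fin (n - 1)) : Equiv.Perm (Fin n) :=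
  Equiv.swap ⟨k, by omega⟩ ⟨k + 1, by omega⟩

theorem exists_word {n : ℕ} (x : Equiv.Perm (Fin n)) :
    ∃ w : List (Fin (n - 1)), (w.map simpleSwap).prod = x := by
  cases n with
  | zero => exact ⟨[], Subsingleton.elim _ _⟩
  | succ m =>
    have hx : x ∈ Submonoid.closure
        (Set.range fun i : Fin m => Equiv.swap i.castSucc i.succ) := by
      rw [Equiv.Perm.mclosure_swap_castSucc_succ]; trivial
    induction hx using Submonoid.closure_induction with
    | mem y hy =>
      obtain ⟨i, rfl⟩ := hy
      exact ⟨[i], by simp [simpleSwap]; rfl⟩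
    | one => exact ⟨[], rfl⟩
    | mul y z _ _ hy hz =>
      obtain ⟨u, rfl⟩ := hy
      obtain ⟨v, rfl⟩ := hz
      exact ⟨u ++ v, by simp⟩

/-- The length of a permutation with respect to the simple transpositions. -/
noncomputable def permLength {n : ℕ} (x : Equiv.Perm (Fin n)) : ℕ :=
  sInf {m | ∃ w : List (Fin (n - 1)), w.length = m ∧ (w.map simpleSwap).prod = x}

theorem exists_reduced_word {n : ℕ} (x : Equiv.Perm (Fin n)) :
    ∃ w : List (Fin (n - 1)), w.length = permLength x ∧ (w.map simpleSwap).prod = x :=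
  Nat.sInf_mem (s := {m | ∃ w : List (Fin (n - 1)), w.length = m ∧ (w.map simpleSwap).prod = x})
    ((exists_word x).elim fun w hw => ⟨w.length, w, rfl, hw⟩)

/-- The positive permutation braid `r(x)` of `x`: the product of the braid generators along a
shortest expression of `x` as a product of simple transpositions (all such expressions give the same
braid, so the choice does not matter). -/
noncomputable def permBraid {n : ℕ} (x : Equiv.Perm (Fin n)) : BraidGroup n :=
  ((exists_reduced_word x).choose.map sigma).prod

/-- The set of all positive permutation braids `r(x)`. -/
def Omega (n : ℕ) : Set (BraidGroup n) := Set.range permBraid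

/-- The submonoid of positive braids, generated by the `σ_k` inside the braid group. -/
def positiveBraids (n : ℕ) : Submonoid (BraidGroup n) := Submonoid.closure (Set.range sigma)

theorem permBraid_mem {n : ℕ} (x : Equiv.Perm (Fin n)) : permBraid x ∈ positiveBraids n := by
  refine Submonoid.list_prod_mem _ fun b hb => ?_
  obtain ⟨k, -, rfl⟩ := List.mem_map.mp hb
  exact Submonoid.subset_closure ⟨k, rfl⟩

theorem Omega_subset {n : ℕ} {x : BraidGroup n} (hx : x ∈ Omega n) : x ∈ positiveBraids n := by
  obtain ⟨w, rfl⟩ := hx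
  exact permBraid_mem w

theorem exists_longest {n : ℕ} (b : positiveBraids n) :
    ∃ x : Equiv.Perm (Fin n), (∃ p ∈ positiveBraids n, (b : BraidGroup n) = permBraid x * p) ∧
      ∀ y : Equiv.Perm (Fin n), (∃ p ∈ positiveBraids n, (b : BraidGroup n) = permBraid y * p) →
        permLength y ≤ permLength x := by
  have h1 : permBraid (1 : Equiv.Perm (Fin n)) = 1 := by
    have hl : permLength (1 : Equiv.Perm (Fin n)) = 0 := Nat.sInf_eq_zero.mpr (Or.inl ⟨[], rfl, rfl⟩)
    have h := (exists_reduced_word (1 : Equiv.Perm (Fin n))).choose_spec.1.trans hl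
    rw [permBraid, List.eq_nil_of_length_eq_zero h]
    rfl
  obtain ⟨x, hx, hmax⟩ := Set.exists_max_image
    {x : Equiv.Perm (Fin n) | ∃ p ∈ positiveBraids n, (b : BraidGroup n) = permBraid x * p}
    permLength (Set.toFinite _) ⟨1, b, b.2, by rw [h1, one_mul]⟩
  exact ⟨x, hx, hmax⟩

/-- The leftmost factor of a positive braid `b`: the braid `r(x)` of the longest permutation `x`
such that `b` is `r(x)` times a positive braid. -/
noncomputable def LF {n : ℕ} (b : positiveBraids n) : BraidGroup n :=
  permBraid (exists_longest b).choose

/-- A set `A` of pairs is a half-permutation if `(i,j), (j,k) ∈ A` implies `(i,k) ∈ A`. -/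
def IsHalfPermutation {n : ℕ} (A : Set (Ref n)) : Prop :=
  ∀ (i j k : Fin n) (hij : i < j) (hjk : j < k),
    ⟨(i, j), hij⟩ ∈ A → ⟨(j, k), hjk⟩ ∈ A → ⟨(i, k), hij.trans hjk⟩ ∈ A

/-- The set of pairs `i < j` with `x⁻¹ i > x⁻¹ j`. -/
def L {n : ℕ} (x : Equiv.Perm (Fin n)) : Set (Ref n) :=
  {s | x⁻¹ s.1.1 > x⁻¹ s.1.2}

theorem exists_perm_of_strictTotal {n : ℕ} (r : Fin n → Fin n → Prop) (hirr : ∀ i, ¬ r i i)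
    (htr : ∀ i j k, r i j → r j k → r i k) (htot : ∀ i j, i ≠ j → r i j ∨ r j i) :
    ∃ x : Equiv.Perm (Fin n), ∀ i j, x⁻¹ i < x⁻¹ j ↔ r i j := by
  classical
  let c : Fin n → Fin n := fun i => ⟨(Finset.univ.filter fun m => r m i).card, by
    calc _ < (Finset.univ : Finset (Fin n)).card := Finset.card_lt_card
            ((Finset.filter_ssubset (p := fun m => r m i)).mpr ⟨i, Finset.mem_univ _, hirr i⟩)
      _ = n := by simp⟩
  have hmono : ∀ i j, r i j → c i < c j := by
    intro i j h
    refine Fin.mk_lt_mk.mpr (Finset.card_lt_card ?_)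
    rw [Finset.ssubset_iff_of_subset]
    · exact ⟨i, by simpa using h, by simpa using hirr i⟩
    · intro m hm
      simp only [Finset.mem_filter, Finset.mem_univ, true_and] at hm ⊢
      exact htr _ _ _ hm h
  have hiff : ∀ i j, c i < c j ↔ r i j := by
    intro i j
    refine ⟨fun h => ?_, hmono i j⟩
    by_contra hr
    rcases eq_or_ne i j with rfl | hne
    · exact lt_irrefl _ h
    · exact lt_asymm h (hmono _ _ ((htot i j hne).resolve_left hr))
  have hinj : Function.Injective c := by
    intro i j h
    by_contra hne
    rcases htot i j hne with h' | h'
    · exact (hmono _ _ h').ne h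
    · exact (hmono _ _ h').ne h.symm
  refine ⟨(Equiv.ofBijective c (Finite.injective_iff_bijective.mp hinj))⁻¹, fun i j => ?_⟩
  rw [inv_inv]
  exact hiff i j

/-- For a half-permutation `A` there is a greatest subset of `A` of the form `L x`. -/
theorem exists_greatest {n : ℕ} {A : Set (Ref n)} (hA : IsHalfPermutation A) :
    ∃ x : Equiv.Perm (Fin n), IsGreatest {B | B ⊆ A ∧ B ∈ Set.range L} (L x) := by
  let N : Fin n → Fin n → Prop := fun i j => ∃ h : i < j, (⟨(i, j), h⟩ : Ref n) ∉ A
  let T := Relation.TransGen N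
  have hlt : ∀ i j, T i j → i < j := by
    intro i j h
    induction h with
    | single h => exact h.1
    | tail _ h ih => exact ih.trans h.1
  have hN : ∀ i j k, i < j → j < k → N i k → N i j ∨ N j k := by
    rintro i j k hij hjk ⟨_, h⟩
    by_contra hcon
    simp only [N, not_or, not_exists, not_not] at hcon
    exact h (hA i j k hij hjk (hcon.1 hij) (hcon.2 hjk))
  have hsplit : ∀ i j k, i < j → j < k → T i k → T i j ∨ T j k := by
    intro i j k hij hjk h
    induction h with
    | single h => exact (hN _ _ _ hij hjk h).imp .single .single
    | @tail b c hib hbc ih =>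
      rcases lt_trichotomy j b with hjb | rfl | hbj
      · exact (ih hjb).imp id fun h => h.tail hbc
      · exact Or.inl hib
      · exact (hN _ _ _ hbj hjk hbc).imp (fun h => hib.tail h) .single
  have htr : ∀ i j k, T i j → T j k → T i k := fun i j k h h' => h.trans h'
  obtain ⟨x, hx⟩ := exists_perm_of_strictTotal (fun i j => T i j ∨ (j < i ∧ ¬ T j i))
    (by
      rintro i (h | h)
      · exact lt_irrefl _ (hlt _ _ h)
      · exact lt_irrefl _ h.1)
    (by
      rintro i j k (h1 | ⟨h1, h1'⟩) (h2 | ⟨h2, h2'⟩)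
      · exact Or.inl (htr _ _ _ h1 h2)
      · rcases lt_trichotomy i k with h | rfl | h
        · exact Or.inl ((hsplit _ _ _ h h2 h1).resolve_right h2')
        · exact absurd h1 h2'
        · exact Or.inr ⟨h, fun h3 => h2' (htr _ _ _ h3 h1)⟩
      · rcases lt_trichotomy i k with h | rfl | h
        · exact Or.inl ((hsplit _ _ _ h1 h h2).resolve_left h1')
        · exact absurd h2 h1'
        · exact Or.inr ⟨h, fun h3 => h1' (htr _ _ _ h2 h3)⟩
      · exact Or.inr ⟨h2.trans h1, fun h3 => (hsplit _ _ _ h2 h1 h3).elim h2' h1'⟩)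
    (by
      intro i j hne
      rcases lt_or_gt_of_ne hne with h | h
      · by_cases hT : T i j
        · exact Or.inl (Or.inl hT)
        · exact Or.inr (Or.inr ⟨h, hT⟩)
      · by_cases hT : T j i
        · exact Or.inr (Or.inl hT)
        · exact Or.inl (Or.inr ⟨h, hT⟩))
  have hL : ∀ s : Ref n, s ∈ L x ↔ ¬ T s.1.1 s.1.2 := by
    intro s
    refine (hx s.1.2 s.1.1).trans ⟨?_, fun h => Or.inr ⟨s.2, h⟩⟩
    rintro (h | h)
    · exact absurd (hlt _ _ h) s.2.not_gt
    · exact h.2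
  refine ⟨x, ⟨fun s hs => ?_, x, rfl⟩, ?_⟩
  · by_contra hsA
    exact (hL s).mp hs (.single ⟨s.2, hsA⟩)
  · rintro _ ⟨hyA, y, rfl⟩ s hs
    refine (hL s).mpr fun hT => ?_
    have key : ∀ i j, T i j → y⁻¹ i < y⁻¹ j := by
      have hstep : ∀ i j, N i j → y⁻¹ i < y⁻¹ j := by
        rintro i j ⟨hij, hnot⟩
        have h1 : ¬ y⁻¹ i > y⁻¹ j := fun h => hnot (hyA h)
        exact lt_of_le_of_ne (not_lt.mp h1) fun h => hij.ne (y⁻¹.injective h)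
      intro i j h
      induction h with
      | single h => exact hstep _ _ h
      | tail _ h ih => exact ih.trans (hstep _ _ h)
    exact lt_asymm (key _ _ hT) hs

/-- The greatest braid `r(x)` of a half-permutation `A`, where `L x` is the greatest subset of `A`
of this form. -/
noncomputable def GB {n : ℕ} (A : Set (Ref n)) (hA : IsHalfPermutation A) : BraidGroup n :=
  permBraid (exists_greatest hA).choose

/-- A positive real number `q` as a unit of the Laurent polynomial ring. -/
noncomputable def qUnit (q : ℝ) (hq : 0 < q) : (LaurentPolynomial ℝ)ˣ :=
  Units.map (LaurentPolynomial.C : ℝ →+* LaurentPolynomial ℝ).toMonoidHom (Units.mk0 q hq.ne')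

/-- The variable `t` as a unit of the Laurent polynomial ring. -/
noncomputable def tUnit : (LaurentPolynomial ℝ)ˣ where
  val := LaurentPolynomial.T 1
  inv := LaurentPolynomial.T (-1)
  val_inv := by rw [← LaurentPolynomial.T_add]; simp
  inv_val := by rw [← LaurentPolynomial.T_add]; simp

/-- Krammer's representation over the ring of real Laurent polynomials in `t`, with `q` a positive
real number. -/
noncomputable def realRep (n : ℕ) (q : ℝ) (hq : 0 < q) :
    BraidGroup n →* (V n (LaurentPolynomial ℝ) ≃ₗ[LaurentPolynomial ℝ] V n (LaurentPolynomial ℝ)) :=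
  krammerRep n (qUnit q hq) tUnit

/-- The set `t ℝ[t]`. -/
def tMultiples : Set (LaurentPolynomial ℝ) :=
  {f | ∃ p : Polynomial ℝ, f = LaurentPolynomial.T 1 * p.toLaurent}

/-- The set `ℝ_{≥ 0} + t ℝ[t]`. -/
def nonnegCone : Set (LaurentPolynomial ℝ) :=
  {f | ∃ a : ℝ, 0 ≤ a ∧ ∃ g ∈ tMultiples, f = LaurentPolynomial.C a + g}

/-- Vectors all of whose coordinates lie in `ℝ_{≥ 0} + t ℝ[t]`. -/
def W (n : ℕ) : Set (V n (LaurentPolynomial ℝ)) := {v | ∀ s, v s ∈ nonnegCone}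

/-- Vectors of `W` whose coordinate at `s` lies in `t ℝ[t]` exactly when `s ∈ A`. -/
def WA {n : ℕ} (A : Set (Ref n)) : Set (V n (LaurentPolynomial ℝ)) :=
  {v | v ∈ W n ∧ ∀ s, v s ∈ tMultiples ↔ s ∈ A}

/-- The union of the sets `WA A` over all half-permutations `A` with greatest braid `x`. -/
def C {n : ℕ} (x : BraidGroup n) : Set (V n (LaurentPolynomial ℝ)) :=
  ⋃ (A : Set (Ref n)) (hA : IsHalfPermutation A) (_ : GB A hA = x), WA A

end Krammer

namespace Krammer

variable {n : ℕ}

/-! Reduction modulo `t` turns the representation into combinatorics of sets of pairs. At `t = 0`,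
with `0 < q < 1`, the matrix of a generator has nonnegative entries, so nothing cancels on vectors
with nonnegative constant coefficients: the set `A` of coordinates vanishing modulo `t` determines
that of the image, namely `star k A` (`realRep_sigma_mem_WA`).

If `k` is a left ascent of `x`, then `star k (L x) = L (simpleSwap k * x)` (`star_L`). For a
half-permutation `A`, the greatest inversion set in `star k A` contains `(k, k + 1)`, and therefore
arises in this way from some `L u ⊆ A` (`exists_ascent_of_L_subset_star`). This has two
consequences. The inversion sets inside `star k A` depend only on those inside `A` (`SameL.star`).
And, by induction on a positive word `w`, the permutation braids dividing `braid w` on the left are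
those with inversions in `starWord w ∅` (`exists_eq_permBraid_mul_iff`), so the leftmost factor is
the greatest braid of that set (`LF_eq_GB`). Replacing a half-permutation by its greatest inversion
set then gives the inclusion for `C`.

For faithfulness, the action of a positive braid determines its set `starWord w ∅`, hence the
generators dividing it on the left. Cancelling them one at a time shows that positive braids with
equal actions are equal (`braid_eq_of_realRep_eq`). This suffices because every braid is a quotient
of two positive ones (`exists_eq_mul_inv`). -/

/-! ### Sets of pairs and the operation of a generator on them -/

/-- Membership of the pair `(i, j)` in `A`, for natural numbers `i` and `j`. -/
def Has (A : Set (Ref n)) (i j : ℕ) : Prop :=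
  ∃ (h : i < j) (hj : j < n), (⟨(⟨i, h.trans hj⟩, ⟨j, hj⟩), h⟩ : Ref n) ∈ A

theorem has_iff {A : Set (Ref n)} (s : Ref n) : Has A s.1.1 s.1.2 ↔ s ∈ A :=
  ⟨fun ⟨_, _, h⟩ => h, fun h => ⟨s.2, s.1.2.2, h⟩⟩

theorem Has.lt {A : Set (Ref n)} {i j : ℕ} (h : Has A i j) : i < j := h.1

theorem subset_iff_has {A B : Set (Ref n)} : A ⊆ B ↔ ∀ i j, Has A i j → Has B i j :=
  ⟨fun h _ _ ⟨h1, h2, h3⟩ => ⟨h1, h2, h h3⟩,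
    fun h s hs => (has_iff s).1 (h _ _ ((has_iff s).2 hs))⟩

theorem isHalfPermutation_iff_has {A : Set (Ref n)} :
    IsHalfPermutation A ↔ ∀ i j k, Has A i j → Has A j k → Has A i k := by
  refine ⟨fun h i j k ⟨h1, h2, h3⟩ ⟨h4, h5, h6⟩ => ⟨h1.trans h4, h5, h _ _ _ h1 h4 h3 h6⟩,
    fun h i j k hij hjk h1 h2 => ?_⟩
  exact (has_iff ⟨(i, k), hij.trans hjk⟩).1
    (h i j k ((has_iff ⟨(i, j), hij⟩).2 h1) ((has_iff ⟨(j, k), hjk⟩).2 h2))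

/-- The effect of `σ_k` on sets of pairs: if `A` is the set of coordinates of `v` that vanish
modulo `t`, then `star k A` is the one of `σ_k v`. -/
def star (k : ℕ) (A : Set (Ref n)) : Set (Ref n) :=
  {s | if (s.1.1 : ℕ) = k then (s.1.2 : ℕ) = k + 1 ∨ Has A (k + 1) s.1.2
    else if (s.1.1 : ℕ) = k + 1 then Has A (k + 1) s.1.2 ∧ Has A k s.1.2
    else if (s.1.2 : ℕ) = k then Has A s.1.1 k ∧ Has A s.1.1 (k + 1)
    else if (s.1.2 : ℕ) = k + 1 then Has A s.1.1 k
    else Has A s.1.1 s.1.2}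

theorem has_star {k : ℕ} {A : Set (Ref n)} {i j : ℕ} : Has (star k A) i j ↔ i < j ∧ j < n ∧
    if i = k then j = k + 1 ∨ Has A (k + 1) j
    else if i = k + 1 then Has A (k + 1) j ∧ Has A k j
    else if j = k then Has A i k ∧ Has A i (k + 1)
    else if j = k + 1 then Has A i k
    else Has A i j :=
  ⟨fun ⟨h1, h2, h3⟩ => ⟨h1, h2, h3⟩, fun ⟨h1, h2, h3⟩ => ⟨h1, h2, h3⟩⟩

theorem star_mono (k : ℕ) {A B : Set (Ref n)} (h : A ⊆ B) : star k A ⊆ star k B := by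
  rw [subset_iff_has] at h ⊢
  intro i j
  simp only [has_star]
  grind

theorem star_isHalfPermutation (k : ℕ) {A : Set (Ref n)} (h : IsHalfPermutation A) :
    IsHalfPermutation (star k A) := by
  rw [isHalfPermutation_iff_has] at h ⊢
  intro i j l
  have h1 := fun a b => Has.lt (A := A) (i := a) (j := b)
  simp only [has_star]
  grind

/-! ### Inversion sets, ascents and length of permutations -/

/-- The position of `i` in the list of values of `x`. -/
def pos (x : Equiv.Perm (Fin n)) (i : ℕ) : ℕ := if h : i < n then x⁻¹ ⟨i, h⟩ else i

theorem pos_inj (x : Equiv.Perm (Fin n)) {i j : ℕ} (hi : i < n) (hj : j < n)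
    (h : pos x i = pos x j) : i = j := by
  simp only [pos, hi, hj, dif_pos] at h
  simpa using x⁻¹.injective (Fin.ext h)

theorem has_L {x : Equiv.Perm (Fin n)} {i j : ℕ} :
    Has (L x) i j ↔ i < j ∧ j < n ∧ pos x j < pos x i := by
  constructor
  · rintro ⟨h1, h2, h3⟩
    refine ⟨h1, h2, ?_⟩
    rw [pos, pos, dif_pos h2, dif_pos (h1.trans h2)]
    exact h3
  · rintro ⟨h1, h2, h3⟩
    refine ⟨h1, h2, ?_⟩
    rw [pos, pos, dif_pos h2, dif_pos (h1.trans h2)] at h3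
    exact h3

theorem pos_simpleSwap_mul (k : Fin (n - 1)) (x : Equiv.Perm (Fin n)) (i : ℕ) :
    pos (simpleSwap k * x) i =
      pos x (if i = k then k + 1 else if i = k + 1 then k else i) := by
  have hk : (k : ℕ) + 1 < n := by omega
  by_cases hi : i < n
  · have h1 : (simpleSwap k)⁻¹ (⟨i, hi⟩ : Fin n) =
        ⟨if i = k then k + 1 else if i = k + 1 then k else i, by split_ifs <;> omega⟩ := by
      rw [simpleSwap, Equiv.swap_inv, Equiv.swap_apply_def]
      simp only [Fin.mk.injEq]
      split_ifs <;> rfl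
    have h2 : (if i = k then (k : ℕ) + 1 else if i = k + 1 then k else i) < n := by
      split_ifs <;> omega
    rw [pos, pos, dif_pos hi, dif_pos h2, mul_inv_rev, Equiv.Perm.mul_apply, h1]
  -- Out of range, both sides are the default value `i`, which the relabelling fixes.
  · rw [if_neg (by omega), if_neg (by omega), pos, pos, dif_neg hi, dif_neg hi]

theorem perm_eq_of_pos {x y : Equiv.Perm (Fin n)} (h : ∀ i, i < n → pos x i = pos y i) :
    x = y := by
  rw [← inv_inj]
  ext i
  simpa [pos] using h i i.2

@[simp]
theorem simpleSwap_mul_self_mul (k : Fin (n - 1)) (x : Equiv.Perm (Fin n)) :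
    simpleSwap k * (simpleSwap k * x) = x := by
  rw [← mul_assoc, simpleSwap, Equiv.swap_mul_self, one_mul]

/-- `k` is a left ascent of `x`. -/
def Ascent (k : Fin (n - 1)) (x : Equiv.Perm (Fin n)) : Prop := pos x k < pos x (k + 1)

theorem not_ascent_iff {k : Fin (n - 1)} {x : Equiv.Perm (Fin n)} :
    ¬ Ascent k x ↔ pos x (k + 1) < pos x k := by
  have h : pos x k ≠ pos x (k + 1) := fun h => by
    have := pos_inj x (by omega) (by omega) h
    omega
  rw [Ascent]
  omega

theorem ascent_simpleSwap_mul {k : Fin (n - 1)} {x : Equiv.Perm (Fin n)} :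
    Ascent k (simpleSwap k * x) ↔ ¬ Ascent k x := by
  rw [not_ascent_iff, Ascent, pos_simpleSwap_mul, pos_simpleSwap_mul]
  simp

theorem has_L_iff_not_ascent {k : Fin (n - 1)} {x : Equiv.Perm (Fin n)} :
    Has (L x) k (k + 1) ↔ ¬ Ascent k x := by
  rw [not_ascent_iff, has_L]
  constructor
  · grind
  · intro h
    exact ⟨by omega, by omega, h⟩

/-- As `k` stands before `k + 1` in `x`, one half of each conjunction in `star` implies the other,
so `star k` just exchanges the labels `k` and `k + 1` and adds the pair `(k, k + 1)`. -/
theorem star_L {k : Fin (n - 1)} {x : Equiv.Perm (Fin n)} (h : Ascent k x) :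
    star k (L x) = L (simpleSwap k * x) := by
  have hk : (k : ℕ) + 1 < n := by omega
  rw [Ascent] at h
  apply Set.Subset.antisymm <;> rw [subset_iff_has] <;> intro i j <;>
    simp only [has_star, has_L, pos_simpleSwap_mul] <;> grind

/-- Each inversion of `x` can be read off from `star k A` at the pair with `k` and `k + 1`
exchanged. The pair `(k, k + 1)` itself, about which `star k A` says nothing, is no inversion
because `k` is an ascent. -/
theorem L_subset_of_star_subset {k : Fin (n - 1)} {x : Equiv.Perm (Fin n)} {A : Set (Ref n)}
    (h : Ascent k x) (hA : star k (L x) ⊆ star k A) : L x ⊆ A := by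
  have hk : (k : ℕ) + 1 < n := by omega
  rw [star_L h] at hA
  rw [Ascent] at h
  rw [subset_iff_has] at hA ⊢
  simp only [has_star, has_L, pos_simpleSwap_mul] at hA ⊢
  rintro i j ⟨hij, hj, hlt⟩
  by_cases h1 : i = k
  · have := hA (k + 1) j
    grind
  by_cases h2 : i = k + 1
  · have := hA k j
    grind
  by_cases h3 : j = k
  · have := hA i (k + 1)
    grind
  by_cases h4 : j = k + 1
  · have := hA i k
    grind
  · have := hA i j
    grind

theorem L_isHalfPermutation (x : Equiv.Perm (Fin n)) : IsHalfPermutation (L x) := by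
  rw [isHalfPermutation_iff_has]
  intro i j k
  simp only [has_L]
  grind

theorem L_one : L (1 : Equiv.Perm (Fin n)) = ∅ :=
  Set.eq_empty_of_forall_notMem fun s hs => lt_asymm s.2 hs

theorem eq_one_of_forall_ascent {x : Equiv.Perm (Fin n)} (h : ∀ k, Ascent k x) : x = 1 := by
  cases n with
  | zero => exact Subsingleton.elim _ _
  | succ m =>
    have hm : StrictMono (x⁻¹ : Equiv.Perm (Fin (m + 1))) := by
      rw [Fin.strictMono_iff_lt_succ]
      intro i
      have := h i
      rw [Ascent, pos, pos, dif_pos (by omega), dif_pos (by omega)] at this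
      exact this
    have h2 := hm.range_inj (strictMono_id)
    rw [← inv_eq_one]
    ext i
    rw [h2.1 (by simp)]
    rfl

theorem eq_one_of_L_eq_empty {x : Equiv.Perm (Fin n)} (h : L x = ∅) : x = 1 := by
  refine eq_one_of_forall_ascent fun k => ?_
  by_contra hk
  obtain ⟨_, _, h1⟩ := has_L_iff_not_ascent.2 hk
  rw [h] at h1
  exact h1

theorem ncard_eq_ncard_has (A : Set (Ref n)) :
    A.ncard = {p : ℕ × ℕ | Has A p.1 p.2}.ncard := by
  have h : {p : ℕ × ℕ | Has A p.1 p.2} =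
      (fun s : Ref n => ((s.1.1 : ℕ), (s.1.2 : ℕ))) '' A := by
    ext p
    constructor
    · rintro ⟨h1, h2, h3⟩
      exact ⟨_, h3, rfl⟩
    · rintro ⟨s, hs, rfl⟩
      exact (has_iff s).2 hs
  rw [h, Set.ncard_image_of_injective]
  intro s s' hs
  simp only [Prod.mk.injEq] at hs
  exact Subtype.ext (Prod.ext (Fin.ext hs.1) (Fin.ext hs.2))

/-- Exchanging the labels `k` and `k + 1` maps the old inversions bijectively onto the new ones
other than `(k, k + 1)`. -/
theorem ncard_L_simpleSwap_mul {k : Fin (n - 1)} {x : Equiv.Perm (Fin n)} (h : Ascent k x) :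
    (L (simpleSwap k * x)).ncard = (L x).ncard + 1 := by
  have hk : (k : ℕ) + 1 < n := by omega
  rw [Ascent] at h
  let τ : ℕ → ℕ := fun i => if i = k then k + 1 else if i = k + 1 then k else i
  have hτ : ∀ i, τ (τ i) = i := by intro i; grind
  have hinj : Function.Injective (Prod.map τ τ) :=
    Function.Injective.prodMap (Function.LeftInverse.injective hτ)
      (Function.LeftInverse.injective hτ)
  have key : {p : ℕ × ℕ | Has (L (simpleSwap k * x)) p.1 p.2} =
      insert ((k : ℕ), (k : ℕ) + 1) (Prod.map τ τ '' {p : ℕ × ℕ | Has (L x) p.1 p.2}) := by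
    ext ⟨i, j⟩
    simp only [Set.mem_ofPred_eq, Set.mem_insert_iff, Set.mem_image, Prod.mk.injEq, Prod.exists,
      Prod.map_apply, has_L, pos_simpleSwap_mul]
    constructor
    · rintro ⟨h1, h2, h3⟩
      by_cases hij : i = k ∧ j = k + 1
      · exact Or.inl hij
      · refine Or.inr ⟨τ i, τ j, ?_, hτ i, hτ j⟩
        grind
    · rintro (⟨rfl, rfl⟩ | ⟨a, b, ⟨h1, h2, h3⟩, rfl, rfl⟩)
      · grind
      · grind
  have hfin : {p : ℕ × ℕ | Has (L x) p.1 p.2}.Finite := by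
    refine Set.Finite.subset ((Set.finite_Iio n).prod (Set.finite_Iio n)) ?_
    rintro p ⟨h1, h2, -⟩
    exact ⟨h1.trans h2, h2⟩
  rw [ncard_eq_ncard_has, key, Set.ncard_insert_of_notMem _ (hfin.image _),
    Set.ncard_image_of_injective _ hinj, ← ncard_eq_ncard_has]
  rintro ⟨⟨i, j⟩, hp, he⟩
  simp only [Set.mem_ofPred_eq, has_L, Prod.map_apply, Prod.mk.injEq] at hp he
  grind

/-- Equal inversion sets have the same descents. Strip off a common one and induct on the number of
inversions. -/
theorem L_injective : Function.Injective (L (n := n)) := by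
  intro x y
  induction hm : (L x).ncard generalizing x y with
  | zero =>
    intro h
    have hx : L x = ∅ := (Set.ncard_eq_zero (Set.toFinite _)).1 hm
    rw [eq_one_of_L_eq_empty hx, eq_one_of_L_eq_empty (x := y) (h ▸ hx)]
  | succ m ih =>
    intro h
    obtain ⟨k, hk⟩ : ∃ k, ¬ Ascent k x := by
      by_contra! hcon
      rw [eq_one_of_forall_ascent hcon, L_one] at hm
      simp at hm
    have hk' : ¬ Ascent k y := by
      rwa [← has_L_iff_not_ascent, ← h, has_L_iff_not_ascent]
    have hx := ascent_simpleSwap_mul.2 hk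
    have hy := ascent_simpleSwap_mul.2 hk'
    have hsx := star_L hx
    have hsy := star_L hy
    have hc := ncard_L_simpleSwap_mul hx
    rw [simpleSwap_mul_self_mul] at hsx hsy hc
    have : simpleSwap k * x = simpleSwap k * y := by
      refine ih (by omega) (Set.Subset.antisymm ?_ ?_)
      · exact L_subset_of_star_subset hx (by rw [hsx, hsy, h])
      · exact L_subset_of_star_subset hy (by rw [hsx, hsy, h])
    exact mul_left_cancel this

/-- Induction on permutations by left multiplication with simple transpositions. -/
theorem perm_induction {P : Equiv.Perm (Fin n) → Prop} (one : P 1)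
    (mul : ∀ k x, Ascent k x → P x → P (simpleSwap k * x)) (x : Equiv.Perm (Fin n)) : P x := by
  induction hm : (L x).ncard generalizing x with
  | zero => rwa [eq_one_of_L_eq_empty ((Set.ncard_eq_zero (Set.toFinite _)).1 hm)]
  | succ m ih =>
    obtain ⟨k, hk⟩ : ∃ k, ¬ Ascent k x := by
      by_contra! hcon
      rw [eq_one_of_forall_ascent hcon, L_one] at hm
      simp at hm
    have hx := ascent_simpleSwap_mul.2 hk
    have hc := ncard_L_simpleSwap_mul hx
    rw [simpleSwap_mul_self_mul] at hc
    simpa using mul k _ hx (ih _ (by omega))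

theorem ncard_L_simpleSwap_mul_of_not_ascent {k : Fin (n - 1)} {x : Equiv.Perm (Fin n)}
    (h : ¬ Ascent k x) : (L (simpleSwap k * x)).ncard + 1 = (L x).ncard := by
  simpa using (ncard_L_simpleSwap_mul (ascent_simpleSwap_mul.2 h)).symm

theorem ncard_L_prod_le (w : List (Fin (n - 1))) :
    (L (w.map simpleSwap).prod).ncard ≤ w.length := by
  induction w with
  | nil => simp [L_one]
  | cons k w ih =>
    rw [List.map_cons, List.prod_cons, List.length_cons]
    by_cases h : Ascent k (w.map simpleSwap).prod
    · rw [ncard_L_simpleSwap_mul h]; omega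
    · have := ncard_L_simpleSwap_mul_of_not_ascent h
      omega

theorem exists_word_length_eq_ncard (x : Equiv.Perm (Fin n)) :
    ∃ w : List (Fin (n - 1)), w.length = (L x).ncard ∧ (w.map simpleSwap).prod = x := by
  induction x using perm_induction with
  | one => exact ⟨[], by simp [L_one]⟩
  | mul k x h ih =>
    obtain ⟨w, h1, h2⟩ := ih
    exact ⟨k :: w, by rw [ncard_L_simpleSwap_mul h, List.length_cons, h1], by simp [h2]⟩

/-- Each letter changes the number of inversions by exactly one, and stripping descents yields a
word attaining the bound. -/
theorem permLength_eq_ncard (x : Equiv.Perm (Fin n)) : permLength x = (L x).ncard := by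
  apply le_antisymm
  · exact Nat.sInf_le (exists_word_length_eq_ncard x)
  · obtain ⟨w, h1, h2⟩ := exists_reduced_word x
    rw [← h1, ← h2]
    exact ncard_L_prod_le w

/-! ### Matsumoto's theorem and permutation braids -/

theorem sigma_comm {k l : Fin (n - 1)} (h : (k : ℕ) + 2 ≤ l) :
    sigma k * sigma l = sigma l * sigma (n := n) k := by
  have := PresentedGroup.one_of_mem (rels := braidRels n) (Or.inl ⟨k, l, h, rfl⟩)
  rwa [map_mul, map_inv, mul_inv_eq_one, map_mul, map_mul] at this

theorem sigma_braid {k l : Fin (n - 1)} (h : (k : ℕ) + 1 = l) :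
    sigma k * (sigma l * sigma k) = sigma l * (sigma k * sigma (n := n) l) := by
  have := PresentedGroup.one_of_mem (rels := braidRels n) (Or.inr ⟨k, l, h, rfl⟩)
  rw [map_mul, map_inv, mul_inv_eq_one] at this
  simp only [map_mul, mul_assoc] at this
  exact this

theorem simpleSwap_comm {k l : Fin (n - 1)} (h : (k : ℕ) + 2 ≤ l) (x : Equiv.Perm (Fin n)) :
    simpleSwap k * (simpleSwap l * x) = simpleSwap l * (simpleSwap k * x) := by
  refine perm_eq_of_pos fun i _ => ?_
  simp only [pos_simpleSwap_mul]
  congr 1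
  split_ifs <;> omega

theorem simpleSwap_braid {k l : Fin (n - 1)} (h : (k : ℕ) + 1 = l) (x : Equiv.Perm (Fin n)) :
    simpleSwap k * (simpleSwap l * (simpleSwap k * x)) =
      simpleSwap l * (simpleSwap k * (simpleSwap l * x)) := by
  refine perm_eq_of_pos fun i _ => ?_
  simp only [pos_simpleSwap_mul, ← h]
  generalize (k : ℕ) = k
  have e1 : k ≠ k + 1 + 1 := by omega
  by_cases h1 : i = k
  · simp [h1, e1, e1.symm]
  by_cases h2 : i = k + 1
  · simp [h2, e1, e1.symm]
  by_cases h3 : i = k + 1 + 1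
  · simp [h3, e1, e1.symm]
  · simp [h1, h2, h3]

/-- The positive braid of a word. -/
def braid (w : List (Fin (n - 1))) : BraidGroup n := (w.map sigma).prod

/-- The permutation of a word. -/
def perm (w : List (Fin (n - 1))) : Equiv.Perm (Fin n) := (w.map simpleSwap).prod

@[simp] theorem braid_nil : braid ([] : List (Fin (n - 1))) = 1 := rfl
@[simp] theorem braid_cons (k : Fin (n - 1)) (w) : braid (k :: w) = sigma k * braid w := by
  simp [braid]
@[simp] theorem braid_append (v w : List (Fin (n - 1))) : braid (v ++ w) = braid v * braid w := by
  simp [braid]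
@[simp] theorem perm_nil : perm ([] : List (Fin (n - 1))) = 1 := rfl
@[simp] theorem perm_cons (k : Fin (n - 1)) (w) : perm (k :: w) = simpleSwap k * perm w := by
  simp [perm]

/-- A word is reduced if its length is the number of inversions of its permutation. -/
def Reduced (w : List (Fin (n - 1))) : Prop := w.length = (L (perm w)).ncard

theorem exists_reduced (x : Equiv.Perm (Fin n)) : ∃ w, Reduced w ∧ perm w = x := by
  obtain ⟨w, h1, h2⟩ := exists_word_length_eq_ncard x
  exact ⟨w, by rw [Reduced, perm, h2, h1], h2⟩

theorem reduced_cons {k : Fin (n - 1)} {w : List (Fin (n - 1))} :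
    Reduced (k :: w) ↔ Reduced w ∧ Ascent k (perm w) := by
  have h0 : (L (perm w)).ncard ≤ w.length := ncard_L_prod_le w
  rw [Reduced, Reduced, perm_cons, List.length_cons]
  by_cases h : Ascent k (perm w)
  · simp [h, ncard_L_simpleSwap_mul h]
  · have := ncard_L_simpleSwap_mul_of_not_ascent h
    simp only [h, and_false, iff_false]
    omega

theorem perm_cons_eq_iff {k : Fin (n - 1)} {x y : Equiv.Perm (Fin n)} :
    simpleSwap k * x = y ↔ x = simpleSwap k * y :=
  ⟨fun h => by rw [← h, simpleSwap_mul_self_mul], fun h => by rw [h, simpleSwap_mul_self_mul]⟩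

/-- Two reduced words of the same permutation give the same braid (Matsumoto). -/
theorem braid_eq_of_perm_eq {v w : List (Fin (n - 1))} (hv : Reduced v) (hw : Reduced w)
    (h : perm v = perm w) : braid v = braid w := by
  induction hm : v.length using Nat.strong_induction_on generalizing v w with
  | _ m ih =>
  have hlen : v.length = w.length := by rw [hv, hw, h]
  rcases v with _ | ⟨k, v⟩
  · rw [List.eq_nil_of_length_eq_zero (l := w) (by simpa using hlen.symm)]
  rcases w with _ | ⟨l, w⟩
  · simp at hlen
  subst hm
  wlog hkl : k ≤ l generalizing k l v w
  · exact (this l w hw k v hv h.symm hlen.symm (by rwa [← hlen]) (le_of_not_ge hkl)).symm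
  rw [reduced_cons] at hv hw
  simp only [List.length_cons, add_left_inj] at hlen ih
  simp only [braid_cons, perm_cons] at h ⊢
  have ih' : ∀ {v' w' : List (Fin (n - 1))}, v'.length < v.length + 1 → Reduced v' → Reduced w' →
      perm v' = perm w' → braid v' = braid w' := fun h1 h2 h3 h4 => ih _ h1 h2 h3 h4 rfl
  obtain ⟨x, hx⟩ : ∃ x, simpleSwap k * perm v = x := ⟨_, rfl⟩
  have hvx : perm v = simpleSwap k * x := perm_cons_eq_iff.1 hx
  have hwx : perm w = simpleSwap l * x := perm_cons_eq_iff.1 (h.symm.trans hx)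
  have hvk : ¬ Ascent k x := by rw [← ascent_simpleSwap_mul, ← hvx]; exact hv.2
  have hwl : ¬ Ascent l x := by rw [← ascent_simpleSwap_mul, ← hwx]; exact hw.2
  rcases hkl.eq_or_lt with rfl | hkl
  · rw [ih' (by omega) hv.1 hw.1 (mul_left_cancel h)]
  rw [Fin.lt_def] at hkl
  rw [not_ascent_iff] at hvk hwl
  rcases Nat.eq_or_lt_of_le (Nat.succ_le_of_lt hkl) with hl | hl
  -- Both `k` and `l = k + 1` are descents of `x`, so the labels `k, k + 1, k + 2` occur in reverse
  -- order. Hence `x` has reduced words beginning with `k l k` and with `l k l`, with common tail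
  -- `c`; induction compares `v` and `w` with them.
  · obtain ⟨c, hc, hcx⟩ := exists_reduced (simpleSwap k * (simpleSwap l * (simpleSwap k * x)))
    rw [← hl] at hwl
    have h1 : Reduced (l :: k :: c) := by
      rw [reduced_cons, reduced_cons, perm_cons, hcx, simpleSwap_mul_self_mul]
      refine ⟨⟨hc, ?_⟩, ?_⟩ <;>
      · simp only [Ascent, pos_simpleSwap_mul, ← hl]
        grind only
    have h2 : Reduced (k :: l :: c) := by
      rw [reduced_cons, reduced_cons, perm_cons, hcx, simpleSwap_braid hl, simpleSwap_mul_self_mul]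
      refine ⟨⟨hc, ?_⟩, ?_⟩ <;>
      · simp only [Ascent, pos_simpleSwap_mul, ← hl]
        grind only
    have e1 : braid v = braid (l :: k :: c) := ih' (by omega) hv.1 h1 (by simp [hcx, hvx])
    have e2 : braid w = braid (k :: l :: c) :=
      ih' (by omega) hw.1 h2 (by simp [hcx, hwx, simpleSwap_braid hl])
    rw [e1, e2]
    simp only [braid_cons]
    rw [← mul_assoc, ← mul_assoc, mul_assoc (sigma k), sigma_braid hl]
    simp only [mul_assoc]
  -- The two descents are far apart, so both letters split off in either order.
  · obtain ⟨c, hc, hcx⟩ := exists_reduced (simpleSwap l * (simpleSwap k * x))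
    have h1 : Reduced (l :: c) := by
      rw [reduced_cons, hcx]
      refine ⟨hc, ?_⟩
      simp only [Ascent, pos_simpleSwap_mul]
      grind only
    have h2 : Reduced (k :: c) := by
      rw [reduced_cons, hcx]
      refine ⟨hc, ?_⟩
      simp only [Ascent, pos_simpleSwap_mul]
      grind only
    have e1 : braid v = braid (l :: c) := ih' (by omega) hv.1 h1 (by simp [hcx, hvx])
    have e2 : braid w = braid (k :: c) :=
      ih' (by omega) hw.1 h2 (by simp [hcx, hwx, ← simpleSwap_comm hl])
    rw [e1, e2]
    simp only [braid_cons]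
    rw [← mul_assoc, ← mul_assoc, sigma_comm (by omega)]

theorem permBraid_eq_braid {x : Equiv.Perm (Fin n)} {w : List (Fin (n - 1))} (hw : Reduced w)
    (h : perm w = x) : permBraid x = braid w := by
  obtain ⟨h1, h2⟩ := (exists_reduced_word x).choose_spec
  refine braid_eq_of_perm_eq ?_ hw (h2.trans h.symm)
  rw [Reduced, perm, h1, h2, permLength_eq_ncard]

theorem permBraid_one : permBraid (1 : Equiv.Perm (Fin n)) = 1 :=
  permBraid_eq_braid (w := []) (by simp [Reduced, L_one]) rfl

theorem permBraid_simpleSwap_mul {k : Fin (n - 1)} {x : Equiv.Perm (Fin n)} (h : Ascent k x) :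
    permBraid (simpleSwap k * x) = sigma k * permBraid x := by
  obtain ⟨w, hw, rfl⟩ := exists_reduced x
  rw [permBraid_eq_braid hw rfl, ← braid_cons]
  exact permBraid_eq_braid (reduced_cons.2 ⟨hw, h⟩) (perm_cons _ _)

theorem eq_sigma_mul_permBraid {k : Fin (n - 1)} {x : Equiv.Perm (Fin n)} (h : ¬ Ascent k x) :
    permBraid x = sigma k * permBraid (simpleSwap k * x) := by
  rw [← permBraid_simpleSwap_mul (ascent_simpleSwap_mul.2 h), simpleSwap_mul_self_mul]

theorem sigma_mem_positiveBraids (k : Fin (n - 1)) : sigma k ∈ positiveBraids n :=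
  Submonoid.subset_closure ⟨k, rfl⟩

theorem braid_mem_positiveBraids (w : List (Fin (n - 1))) : braid w ∈ positiveBraids n := by
  refine Submonoid.list_prod_mem _ fun b hb => ?_
  obtain ⟨k, -, rfl⟩ := List.mem_map.mp hb
  exact sigma_mem_positiveBraids k

theorem exists_braid_eq {b : BraidGroup n} (hb : b ∈ positiveBraids n) : ∃ w, braid w = b := by
  induction hb using Submonoid.closure_induction with
  | mem y hy =>
    obtain ⟨k, rfl⟩ := hy
    exact ⟨[k], by simp⟩
  | one => exact ⟨[], rfl⟩
  | mul y z _ _ hy hz =>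
    obtain ⟨u, rfl⟩ := hy
    obtain ⟨v, rfl⟩ := hz
    exact ⟨u ++ v, braid_append _ _⟩

/-! ### Divisibility and fractions of positive braids -/

/-- Inclusion of inversion sets implies left divisibility of permutation braids. -/
theorem exists_permBraid_eq_mul {x y : Equiv.Perm (Fin n)} (h : L x ⊆ L y) :
    ∃ p ∈ positiveBraids n, permBraid y = permBraid x * p := by
  induction x using perm_induction generalizing y with
  | one => exact ⟨_, permBraid_mem y, by rw [permBraid_one, one_mul]⟩
  | mul k x hk ih =>
    have hx : ¬ Ascent k (simpleSwap k * x) := by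
      rw [← ascent_simpleSwap_mul, simpleSwap_mul_self_mul]; exact hk
    have hy : ¬ Ascent k y := by
      rw [← has_L_iff_not_ascent] at hx ⊢
      exact subset_iff_has.1 h _ _ hx
    have hs := star_L (ascent_simpleSwap_mul.2 hy)
    rw [simpleSwap_mul_self_mul] at hs
    obtain ⟨p, hp, e⟩ :=
      ih (y := simpleSwap k * y) (L_subset_of_star_subset hk (by rwa [star_L hk, hs]))
    exact ⟨p, hp, by
      rw [eq_sigma_mul_permBraid hy, e, permBraid_simpleSwap_mul hk, mul_assoc]⟩

theorem subset_L_revPerm (A : Set (Ref n)) : A ⊆ L (Fin.revPerm : Equiv.Perm (Fin n)) :=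
  fun s _ => Fin.rev_lt_rev.2 s.2

/-- A positive braid and a permutation braid have a common right multiple. -/
theorem exists_mul_permBraid_eq {b : BraidGroup n} (hb : b ∈ positiveBraids n)
    (x : Equiv.Perm (Fin n)) :
    ∃ y, ∃ p ∈ positiveBraids n, b * permBraid y = permBraid x * p := by
  induction hb using Submonoid.closure_induction_left generalizing x with
  | one => exact ⟨x, 1, one_mem _, by simp⟩
  | mul_left a ha b _ ih =>
    obtain ⟨k, rfl⟩ := ha
    have hk : ¬ Ascent k (Fin.revPerm : Equiv.Perm (Fin n)) :=
      has_L_iff_not_ascent.1 (subset_iff_has.1 (subset_L_revPerm Set.univ) _ _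
        ⟨by omega, by omega, trivial⟩)
    -- With `w₀ = Fin.revPerm`, multiplying by `sigma k` completes this permutation braid to the
    -- half twist `permBraid w₀`, which every permutation braid divides on the left.
    obtain ⟨y, p, hp, e⟩ := ih (simpleSwap k * Fin.revPerm)
    obtain ⟨c, hc, e'⟩ := exists_permBraid_eq_mul (subset_L_revPerm (L x))
    exact ⟨y, c * p, mul_mem hc hp, by
      rw [mul_assoc, e, ← mul_assoc, ← eq_sigma_mul_permBraid hk, e', mul_assoc]⟩

theorem permBraid_simpleSwap (k : Fin (n - 1)) : permBraid (simpleSwap k) = sigma k := by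
  have h : Ascent k (1 : Equiv.Perm (Fin n)) := by
    rw [Ascent, pos, pos, dif_pos (by omega), dif_pos (by omega)]
    simp
  simpa [permBraid_one] using permBraid_simpleSwap_mul h

/-- The braid group is the group of fractions of the positive braids. -/
theorem exists_eq_mul_inv (b : BraidGroup n) :
    ∃ x ∈ positiveBraids n, ∃ y ∈ positiveBraids n, b = x * y⁻¹ := by
  have hb : b ∈ Subgroup.closure (Set.range (sigma (n := n))) := by
    rw [show Set.range (sigma (n := n)) = Set.range (PresentedGroup.of (rels := braidRels n))
      from rfl, PresentedGroup.closure_range_of]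
    trivial
  induction hb using Subgroup.closure_induction_left with
  | one => exact ⟨1, one_mem _, 1, one_mem _, by simp⟩
  | mul_left a ha b _ ih =>
    obtain ⟨x, hx, y, hy, rfl⟩ := ih
    obtain ⟨k, rfl⟩ := ha
    exact ⟨_, mul_mem (sigma_mem_positiveBraids k) hx, y, hy, by rw [mul_assoc]⟩
  | inv_mul_cancel a ha b _ ih =>
    obtain ⟨x, hx, y, hy, rfl⟩ := ih
    obtain ⟨k, rfl⟩ := ha
    -- From `x * permBraid z = sigma k * p`, the inverse generator moves past `x` to the
    -- denominator.
    obtain ⟨z, p, hp, e⟩ := exists_mul_permBraid_eq hx (simpleSwap k)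
    rw [permBraid_simpleSwap] at e
    refine ⟨p, hp, y * permBraid z, mul_mem hy (permBraid_mem z), ?_⟩
    rw [eq_inv_mul_iff_mul_eq.2 e.symm]
    group

/-! ### Reduction modulo `t` -/

/-- `f` is a polynomial in `t` with constant coefficient `a`. -/
def HasConstCoeff (f : LaurentPolynomial ℝ) (a : ℝ) : Prop :=
  ∃ p : Polynomial ℝ, f = p.toLaurent ∧ p.coeff 0 = a

namespace HasConstCoeff

variable {f g : LaurentPolynomial ℝ} {a b : ℝ}

theorem zero : HasConstCoeff 0 0 := ⟨0, by simp⟩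

theorem one : HasConstCoeff 1 1 := ⟨1, by simp⟩

theorem const (a : ℝ) : HasConstCoeff (LaurentPolynomial.C a) a :=
  ⟨Polynomial.C a, by simp⟩

theorem T_one : HasConstCoeff (LaurentPolynomial.T 1) 0 :=
  ⟨Polynomial.X, by simp⟩

theorem add (hf : HasConstCoeff f a) (hg : HasConstCoeff g b) : HasConstCoeff (f + g) (a + b) := by
  obtain ⟨p, rfl, rfl⟩ := hf
  obtain ⟨p', rfl, rfl⟩ := hg
  exact ⟨p + p', by simp⟩

theorem sub (hf : HasConstCoeff f a) (hg : HasConstCoeff g b) : HasConstCoeff (f - g) (a - b) := by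
  obtain ⟨p, rfl, rfl⟩ := hf
  obtain ⟨p', rfl, rfl⟩ := hg
  exact ⟨p - p', by simp⟩

theorem mul (hf : HasConstCoeff f a) (hg : HasConstCoeff g b) : HasConstCoeff (f * g) (a * b) := by
  obtain ⟨p, rfl, rfl⟩ := hf
  obtain ⟨p', rfl, rfl⟩ := hg
  exact ⟨p * p', by simp [Polynomial.mul_coeff_zero]⟩

theorem pow (hf : HasConstCoeff f a) (m : ℕ) : HasConstCoeff (f ^ m) (a ^ m) := by
  induction m with
  | zero => simpa using one
  | succ m ih => simpa only [pow_succ] using ih.mul hf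

theorem sum {ι : Type*} {s : Finset ι} {f : ι → LaurentPolynomial ℝ} {a : ι → ℝ}
    (h : ∀ i, HasConstCoeff (f i) (a i)) : HasConstCoeff (∑ i ∈ s, f i) (∑ i ∈ s, a i) := by
  classical
  induction s using Finset.induction_on with
  | empty => simpa using zero
  | insert i s hi ih =>
    rw [Finset.sum_insert hi, Finset.sum_insert hi]
    exact (h i).add ih

theorem mem_tMultiples_iff (h : HasConstCoeff f a) : f ∈ tMultiples ↔ a = 0 := by
  obtain ⟨p, rfl, rfl⟩ := h
  rw [← Polynomial.X_dvd_iff]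
  constructor
  · rintro ⟨r, hr⟩
    refine ⟨r, Polynomial.toLaurent_injective ?_⟩
    rw [hr, map_mul, Polynomial.toLaurent_X]
  · rintro ⟨r, rfl⟩
    exact ⟨r, by rw [map_mul, Polynomial.toLaurent_X]⟩

end HasConstCoeff

theorem mem_nonnegCone_iff {f : LaurentPolynomial ℝ} :
    f ∈ nonnegCone ↔ ∃ a, 0 ≤ a ∧ HasConstCoeff f a := by
  constructor
  · rintro ⟨a, ha, _, ⟨p, rfl⟩, rfl⟩
    refine ⟨a, ha, ?_⟩
    simpa using (HasConstCoeff.const a).add (HasConstCoeff.T_one.mul ⟨p, rfl, rfl⟩)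
  · rintro ⟨_, ha, p, rfl, rfl⟩
    refine ⟨_, ha, _, ⟨p.divX, rfl⟩, ?_⟩
    rw [← Polynomial.toLaurent_C, ← Polynomial.toLaurent_X, ← map_mul, ← map_add, add_comm,
      Polynomial.X_mul_divX_add]

/-- Modulo `t`, membership in `W_A` is a condition on the vector of constant coefficients. -/
theorem mem_WA_iff {A : Set (Ref n)} {v : V n (LaurentPolynomial ℝ)} :
    v ∈ WA A ↔ ∃ a : Ref n → ℝ, (∀ s, HasConstCoeff (v s) (a s)) ∧ (∀ s, 0 ≤ a s) ∧
      ∀ s, a s = 0 ↔ s ∈ A := by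
  constructor
  · rintro ⟨h1, h2⟩
    choose a ha hv using fun s => mem_nonnegCone_iff.1 (h1 s)
    exact ⟨a, hv, ha, fun s => by rw [← (hv s).mem_tMultiples_iff, h2]⟩
  · rintro ⟨a, hv, ha, h⟩
    exact ⟨fun s => mem_nonnegCone_iff.2 ⟨a s, ha s, hv s⟩,
      fun s => by rw [(hv s).mem_tMultiples_iff, h]⟩

theorem WA_nonempty (A : Set (Ref n)) : (WA A).Nonempty := by
  classical
  refine ⟨Finsupp.equivFunOnFinite.symm fun s => LaurentPolynomial.C (if s ∈ A then 0 else 1),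
    mem_WA_iff.2 ⟨fun s => if s ∈ A then 0 else 1, fun s => .const _, fun s => ?_, fun s => ?_⟩⟩
  · dsimp only
    split_ifs <;> simp
  · simp

theorem xvec_apply {R : Type*} [CommRing R] (i j : ℕ) (s : Ref n) :
    xvec n R i j s = if (s.1.1 : ℕ) = i ∧ (s.1.2 : ℕ) = j then 1 else 0 := by
  unfold xvec
  by_cases h : i < j ∧ j < n
  · rw [dif_pos h, Finsupp.single_apply]
    congr 1
    rw [Subtype.ext_iff, Prod.ext_iff, Fin.ext_iff, Fin.ext_iff, eq_comm]
    simp only [eq_comm]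
  · rw [dif_neg h, if_neg]
    · rfl
    · rintro ⟨rfl, rfl⟩
      exact h ⟨s.2, s.1.2.2⟩

theorem sigmaMap_apply {R : Type*} [CommRing R] (q t : R) (k : ℕ) (v : V n R) (s : Ref n) :
    sigmaMap n q t k v s = ∑ r : Ref n, v r * sigmaValue n q t k r.1.1 r.1.2 s := by
  rw [sigmaMap, Finsupp.linearCombination_apply, Finsupp.sum_fintype _ _ (by simp),
    Finsupp.finsetSum_apply]
  rfl

theorem hasConstCoeff_xvec (i j : ℕ) (s : Ref n) :
    HasConstCoeff (xvec n (LaurentPolynomial ℝ) i j s) (xvec n ℝ i j s) := by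
  rw [xvec_apply, xvec_apply]
  split_ifs
  exacts [.one, .zero]

/-- The matrix has no negative powers of `t`, so its reduction modulo `t` is the same formula over
the reals with `t = 0`. -/
theorem hasConstCoeff_sigmaValue (q : ℝ) (k i j : ℕ) (s : Ref n) :
    HasConstCoeff (sigmaValue n (LaurentPolynomial.C q) (LaurentPolynomial.T 1) k i j s)
      (sigmaValue n q 0 k i j s) := by
  have hx := fun i j => hasConstCoeff_xvec i j s
  have hq := HasConstCoeff.const q
  have ht := HasConstCoeff.T_one
  have h1 := HasConstCoeff.one
  unfold sigmaValue
  split_ifs <;> try simp only [Finsupp.add_apply, Finsupp.smul_apply, smul_eq_mul]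
  · exact hx _ _
  · exact (hx _ _).add ((h1.sub hq).mul (hx _ _))
  · exact (((ht.mul hq).mul (hq.sub h1)).mul (hx _ _)).add (hq.mul (hx _ _))
  · exact (ht.mul (hq.pow _)).mul (hx _ _)
  · exact (hx _ _).add (((ht.mul (hq.pow _)).mul ((hq.sub h1).pow _)).mul (hx _ _))
  · exact (hx _ _).add (((ht.mul (hq.pow _)).mul (hq.sub h1)).mul (hx _ _))
  · exact ((h1.sub hq).mul (hx _ _)).add (hq.mul (hx _ _))

/-- The coefficients surviving at `t = 0` are `1`, `q` and `1 - q`. -/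
theorem sigmaValue_zero_nonneg {q : ℝ} (hq0 : 0 < q) (hq1 : q < 1) (k i j : ℕ) (s : Ref n) :
    0 ≤ sigmaValue n q 0 k i j s := by
  have h : 0 < 1 - q := by linarith
  have hx : ∀ i j, 0 ≤ xvec n ℝ i j s := fun i j => by
    rw [xvec_apply]; split_ifs <;> simp
  unfold sigmaValue
  split_ifs <;> simp only [Finsupp.add_apply, Finsupp.smul_apply, smul_eq_mul, zero_mul, zero_add,
      add_zero, le_refl, hx]
  · have := hx (i - 1) j; have := hx i j; positivity
  · have := hx (i + 1) j; positivity
  · have := hx i j; have := hx i (j + 1); positivity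

theorem sigmaValue_zero_ne_zero_iff {q : ℝ} (hq0 : 0 < q) (hq1 : q < 1) (k i j : ℕ) (s : Ref n) :
    sigmaValue n q 0 k i j s ≠ 0 ↔
      if k + 1 < i ∨ j < k then (s.1.1 : ℕ) = i ∧ (s.1.2 : ℕ) = j
      else if k + 1 = i then ((s.1.1 : ℕ) = k ∨ (s.1.1 : ℕ) = i) ∧ (s.1.2 : ℕ) = j
      else if k = i ∧ k + 1 < j then (s.1.1 : ℕ) = i + 1 ∧ (s.1.2 : ℕ) = j
      else if k = i ∧ k + 1 = j then False
      else if i < k ∧ k + 1 < j then (s.1.1 : ℕ) = i ∧ (s.1.2 : ℕ) = j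
      else if k + 1 = j then (s.1.1 : ℕ) = i ∧ (s.1.2 : ℕ) + 1 = j
      else (s.1.1 : ℕ) = i ∧ ((s.1.2 : ℕ) = j ∨ (s.1.2 : ℕ) = j + 1) := by
  have h : 1 - q ≠ 0 := by linarith
  have hq := hq0.ne'
  unfold sigmaValue
  split_ifs <;> simp only [Finsupp.add_apply, Finsupp.smul_apply, smul_eq_mul, zero_mul, zero_add,
      add_zero, xvec_apply] <;> grind

/-- Identifies the combinatorial definition of `star` with the support of the matrix at `t = 0`:
coordinate `s` of the image vanishes when all coordinates feeding into it do. -/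
theorem mem_star_iff {q : ℝ} (hq0 : 0 < q) (hq1 : q < 1) {k : ℕ} (hk : k + 1 < n)
    (A : Set (Ref n)) (s : Ref n) : s ∈ star k A ↔
      ∀ r : Ref n, sigmaValue n q 0 k r.1.1 r.1.2 s ≠ 0 → r ∈ A := by
  have hA : (∀ r : Ref n, sigmaValue n q 0 k r.1.1 r.1.2 s ≠ 0 → r ∈ A) ↔
      ∀ i j, i < j → j < n → sigmaValue n q 0 k i j s ≠ 0 → Has A i j := by
    refine ⟨fun h i j hij hj hs => ⟨hij, hj, h ⟨(⟨i, hij.trans hj⟩, ⟨j, hj⟩), hij⟩ hs⟩,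
      fun h r hr => (has_iff r).1 (h _ _ r.2 r.1.2.2 hr)⟩
  rw [hA, ← has_iff, has_star]
  simp only [sigmaValue_zero_ne_zero_iff hq0 hq1]
  have h1 : (s.1.1 : ℕ) < s.1.2 := s.2
  have h2 : (s.1.2 : ℕ) < n := s.1.2.2
  clear hA
  generalize (s.1.1 : ℕ) = i at *
  generalize (s.1.2 : ℕ) = j at *
  clear s hq0 hq1
  constructor
  · rintro ⟨-, -, h⟩ a b hab hb
    have hb' : b < k ∨ b = k ∨ b = k + 1 ∨ k + 1 < b := by omega
    rcases hb' with hb' | rfl | rfl | hb' <;> grind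
  · intro h
    refine ⟨h1, h2, ?_⟩
    -- At `t = 0` only the pair itself and its four neighbours can contribute to `x_{i,j}`.
    have e1 := h i j
    have e2 := h (i + 1) j
    have e3 := h (i - 1) j
    have e4 := h i (j + 1)
    have e5 := h i (j - 1)
    clear h
    grind

theorem realRep_sigma {q : ℝ} (hq : 0 < q) (k : Fin (n - 1)) (v : V n (LaurentPolynomial ℝ)) :
    realRep n q hq (sigma k) v =
      sigmaMap n (LaurentPolynomial.C q) (LaurentPolynomial.T 1) k v := by
  rw [realRep, krammerRep, sigma, PresentedGroup.toGroup.of, sigmaEquiv_apply]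
  rfl

/-- A sum of nonnegative terms vanishes only if each term does, so zero patterns transform by the
support of the matrix alone. -/
theorem realRep_sigma_mem_WA {q : ℝ} (hq0 : 0 < q) (hq1 : q < 1) (k : Fin (n - 1))
    {A : Set (Ref n)} {v : V n (LaurentPolynomial ℝ)} (hv : v ∈ WA A) :
    realRep n q hq0 (sigma k) v ∈ WA (star k A) := by
  obtain ⟨a, h1, h2, h3⟩ := mem_WA_iff.1 hv
  have hM := sigmaValue_zero_nonneg (n := n) hq0 hq1 k
  refine mem_WA_iff.2 ⟨fun s => ∑ r : Ref n, a r * sigmaValue n q 0 k r.1.1 r.1.2 s,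
    fun s => ?_, fun s => Finset.sum_nonneg fun r _ => mul_nonneg (h2 r) (hM _ _ _), fun s => ?_⟩
  · rw [realRep_sigma, sigmaMap_apply]
    exact .sum fun r => (h1 r).mul (hasConstCoeff_sigmaValue _ _ _ _ _)
  · rw [Finset.sum_eq_zero_iff_of_nonneg fun r _ => mul_nonneg (h2 r) (hM _ _ _),
      mem_star_iff hq0 hq1 (by omega)]
    refine forall_congr' fun r => ?_
    simp only [Finset.mem_univ, true_imp_iff, mul_eq_zero, h3]
    tauto

/-! ### Inversion sets inside half-permutations -/

theorem exists_GB_eq {A : Set (Ref n)} (hA : IsHalfPermutation A) :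
    ∃ x, (∀ y, L y ⊆ A ↔ L y ⊆ L x) ∧ GB A hA = permBraid x := by
  obtain ⟨⟨h1, -⟩, h2⟩ := (exists_greatest hA).choose_spec
  exact ⟨_, fun y => ⟨fun h => h2 ⟨h, y, rfl⟩, fun h => h.trans h1⟩, rfl⟩

/-- `A` and `B` contain the same inversion sets of permutations. -/
def SameL (A B : Set (Ref n)) : Prop := ∀ x, L x ⊆ A ↔ L x ⊆ B

theorem SameL.symm {A B : Set (Ref n)} (h : SameL A B) : SameL B A := fun x => (h x).symm

theorem SameL.GB_eq {A B : Set (Ref n)} (h : SameL A B) (hA : IsHalfPermutation A)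
    (hB : IsHalfPermutation B) : GB A hA = GB B hB := by
  obtain ⟨x, hx, ex⟩ := exists_GB_eq hA
  obtain ⟨y, hy, ey⟩ := exists_GB_eq hB
  rw [ex, ey, L_injective (Set.Subset.antisymm ((hy x).1 ((h x).1 ((hx x).2 le_rfl)))
    ((hx y).1 ((h y).2 ((hy y).2 le_rfl))))]

/-- Every inversion set inside `star k A` lies in one that comes from an inversion set in `A`. -/
theorem exists_ascent_of_L_subset_star {k : Fin (n - 1)} {A : Set (Ref n)}
    (hA : IsHalfPermutation A) {x : Equiv.Perm (Fin n)} (hx : L x ⊆ star k A) :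
    ∃ u, Ascent k u ∧ L u ⊆ A ∧ L x ⊆ L (simpleSwap k * u) := by
  obtain ⟨y, hy, -⟩ := exists_GB_eq (star_isHalfPermutation k hA)
  have h1 : Ascent k (1 : Equiv.Perm (Fin n)) := by
    rw [Ascent, pos, pos, dif_pos (by omega), dif_pos (by omega)]
    simp
  -- The set `star k ∅ = L (simpleSwap k)` lies in `star k A`, hence in its greatest inversion set
  -- `L y`.
  have hyk : ¬ Ascent k y := by
    have h2 : Has (L (simpleSwap k * (1 : Equiv.Perm (Fin n)))) k (k + 1) := by
      rw [has_L_iff_not_ascent, ← ascent_simpleSwap_mul, simpleSwap_mul_self_mul]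
      exact h1
    rw [← has_L_iff_not_ascent]
    refine subset_iff_has.1 ((hy _).1 ?_) _ _ h2
    rw [← star_L h1, L_one]
    exact star_mono _ (Set.empty_subset _)
  have hu := ascent_simpleSwap_mul.2 hyk
  refine ⟨_, hu, L_subset_of_star_subset hu ?_, ?_⟩
  · rw [star_L hu, simpleSwap_mul_self_mul]
    exact (hy y).2 le_rfl
  · rw [simpleSwap_mul_self_mul]
    exact (hy x).1 hx

theorem SameL.star {A B : Set (Ref n)} (h : SameL A B) (hA : IsHalfPermutation A)
    (hB : IsHalfPermutation B) (k : Fin (n - 1)) : SameL (star k A) (star k B) := by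
  have key : ∀ {A B : Set (Ref n)}, SameL A B → IsHalfPermutation A →
      ∀ x, L x ⊆ Krammer.star k A → L x ⊆ Krammer.star k B := by
    intro A B h hA x hx
    obtain ⟨u, hu, huA, hxu⟩ := exists_ascent_of_L_subset_star hA hx
    rw [← star_L hu] at hxu
    exact hxu.trans (star_mono _ ((h u).1 huA))
  exact fun x => ⟨key h hA x, key h.symm hB x⟩

/-! ### Positive words acting on sets of pairs -/

/-- The effect of a positive word on sets of pairs. -/
def starWord (w : List (Fin (n - 1))) (A : Set (Ref n)) : Set (Ref n) :=
  w.foldr (fun (k : Fin (n - 1)) A => star k A) A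

theorem starWord_cons (k : Fin (n - 1)) (w : List (Fin (n - 1))) (A : Set (Ref n)) :
    starWord (k :: w) A = star k (starWord w A) := rfl

theorem starWord_append (v w : List (Fin (n - 1))) (A : Set (Ref n)) :
    starWord (v ++ w) A = starWord v (starWord w A) := by
  simp only [starWord, List.foldr_append]

theorem starWord_mono (w : List (Fin (n - 1))) {A B : Set (Ref n)} (h : A ⊆ B) :
    starWord w A ⊆ starWord w B := by
  induction w with
  | nil => exact h
  | cons k w ih => exact star_mono k ih

theorem starWord_isHalfPermutation (w : List (Fin (n - 1))) {A : Set (Ref n)}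
    (hA : IsHalfPermutation A) : IsHalfPermutation (starWord w A) := by
  induction w with
  | nil => exact hA
  | cons k w ih => exact star_isHalfPermutation k ih

theorem SameL.starWord {A B : Set (Ref n)} (h : SameL A B) (hA : IsHalfPermutation A)
    (hB : IsHalfPermutation B) (w : List (Fin (n - 1))) :
    SameL (starWord w A) (starWord w B) := by
  induction w with
  | nil => exact h
  | cons k w ih =>
    exact ih.star (starWord_isHalfPermutation w hA) (starWord_isHalfPermutation w hB) k

theorem starWord_empty_of_reduced {w : List (Fin (n - 1))} (hw : Reduced w) :
    starWord w ∅ = L (perm w) := by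
  induction w with
  | nil => exact L_one.symm
  | cons k w ih =>
    rw [reduced_cons] at hw
    rw [starWord_cons, ih hw.1, star_L hw.2, perm_cons]

theorem isHalfPermutation_empty : IsHalfPermutation (∅ : Set (Ref n)) :=
  fun _ _ _ _ _ h => h.elim

section Action

variable {q : ℝ} (hq0 : 0 < q)

theorem realRep_braid_mem_WA (hq1 : q < 1) (w : List (Fin (n - 1))) {A : Set (Ref n)}
    {v : V n (LaurentPolynomial ℝ)} (hv : v ∈ WA A) :
    realRep n q hq0 (braid w) v ∈ WA (starWord w A) := by
  induction w with
  | nil => simpa [starWord] using hv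
  | cons k w ih =>
    rw [braid_cons, map_mul]
    exact realRep_sigma_mem_WA hq0 hq1 k ih

theorem eq_of_mem_WA {A B : Set (Ref n)} {v : V n (LaurentPolynomial ℝ)} (hA : v ∈ WA A)
    (hB : v ∈ WA B) : A = B :=
  Set.ext fun s => (hA.2 s).symm.trans (hB.2 s)

/-- Every `WA A` is nonempty, and a vector lies in at most one of these sets. -/
theorem starWord_eq_of_realRep_eq (hq1 : q < 1) {v w : List (Fin (n - 1))}
    (h : realRep n q hq0 (braid v) = realRep n q hq0 (braid w)) (A : Set (Ref n)) :
    starWord v A = starWord w A := by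
  obtain ⟨a, ha⟩ := WA_nonempty A
  refine eq_of_mem_WA (realRep_braid_mem_WA hq0 hq1 v ha) ?_
  rw [h]
  exact realRep_braid_mem_WA hq0 hq1 w ha

end Action

/-- The braid relations for `star` are inherited from the representation; any `q` strictly between
`0` and `1` would do. -/
theorem starWord_eq_of_braid_eq {v w : List (Fin (n - 1))} (h : braid v = braid w)
    (A : Set (Ref n)) : starWord v A = starWord w A :=
  starWord_eq_of_realRep_eq (q := 1 / 2) (by norm_num) (by norm_num) (by rw [h]) A

/-- For a word `k :: w`, `x` lies below some `simpleSwap k * u` with `k` an ascent of `u` and `L u`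
inside the set of `w`. By induction `permBraid u` divides `braid w`; multiply by `sigma k`. -/
theorem exists_eq_permBraid_mul_of_L_subset {w : List (Fin (n - 1))} {x : Equiv.Perm (Fin n)}
    (h : L x ⊆ starWord w ∅) : ∃ p ∈ positiveBraids n, braid w = permBraid x * p := by
  induction w generalizing x with
  | nil =>
    rw [eq_one_of_L_eq_empty (Set.subset_empty_iff.1 h), permBraid_one]
    exact ⟨1, one_mem _, by simp⟩
  | cons k w ih =>
    obtain ⟨u, hu, huw, hxu⟩ := exists_ascent_of_L_subset_star
      (starWord_isHalfPermutation w isHalfPermutation_empty) h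
    obtain ⟨p, hp, ep⟩ := ih huw
    obtain ⟨c, hc, ec⟩ := exists_permBraid_eq_mul hxu
    refine ⟨c * p, mul_mem hc hp, ?_⟩
    rw [braid_cons, ep, ← mul_assoc, ← permBraid_simpleSwap_mul hu, ec, mul_assoc]

/-- A permutation braid divides a positive braid on the left if and only if its inversions lie in
the set of pairs attached to that braid. -/
theorem exists_eq_permBraid_mul_iff (w : List (Fin (n - 1))) (x : Equiv.Perm (Fin n)) :
    (∃ p ∈ positiveBraids n, braid w = permBraid x * p) ↔ L x ⊆ starWord w ∅ := by
  refine ⟨?_, exists_eq_permBraid_mul_of_L_subset⟩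
  rintro ⟨p, hp, e⟩
  obtain ⟨v, rfl⟩ := exists_braid_eq hp
  obtain ⟨u, hu, rfl⟩ := exists_reduced x
  rw [permBraid_eq_braid hu rfl, ← braid_append] at e
  -- For a factorization with reduced first word `u`, monotonicity applied to `∅ ⊆ starWord v ∅`
  -- gives the inclusion.
  rw [starWord_eq_of_braid_eq e, starWord_append, ← starWord_empty_of_reduced hu]
  exact starWord_mono _ (Set.empty_subset _)

/-! ### Leftmost factors and the sets `C` -/

/-- Left divisors correspond to inversion sets in `starWord w ∅`. The greatest of these contains
that of the longest divisor and has no more elements, so they agree. -/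
theorem LF_eq_GB {b : positiveBraids n} {w : List (Fin (n - 1))} (h : (b : BraidGroup n) = braid w) :
    LF b = GB (starWord w ∅) (starWord_isHalfPermutation w isHalfPermutation_empty) := by
  obtain ⟨x, e', h1, h2⟩ : ∃ x, LF b = permBraid x ∧
      (∃ p ∈ positiveBraids n, (b : BraidGroup n) = permBraid x * p) ∧
      ∀ y : Equiv.Perm (Fin n), (∃ p ∈ positiveBraids n, (b : BraidGroup n) = permBraid y * p) →
        permLength y ≤ permLength x := ⟨_, rfl, (exists_longest b).choose_spec⟩
  simp only [h, exists_eq_permBraid_mul_iff, permLength_eq_ncard] at h1 h2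
  obtain ⟨y, hy, e⟩ := exists_GB_eq (starWord_isHalfPermutation w isHalfPermutation_empty)
  rw [e, e']
  congr 1
  exact L_injective (Set.eq_of_subset_of_ncard_le ((hy _).1 h1) (h2 y ((hy y).2 le_rfl)))

theorem mem_C_iff {b : BraidGroup n} {v : V n (LaurentPolynomial ℝ)} :
    v ∈ C b ↔ ∃ (A : Set (Ref n)) (hA : IsHalfPermutation A), GB A hA = b ∧ v ∈ WA A := by
  simp [C]

theorem C_nonempty {x : BraidGroup n} (hx : x ∈ Omega n) : (C x).Nonempty := by
  obtain ⟨x, rfl⟩ := hx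
  obtain ⟨v, hv⟩ := WA_nonempty (L x)
  obtain ⟨y, hy, e⟩ := exists_GB_eq (L_isHalfPermutation x)
  refine ⟨v, mem_C_iff.2 ⟨_, L_isHalfPermutation x, ?_, hv⟩⟩
  rw [e, L_injective (Set.Subset.antisymm ((hy y).2 le_rfl) ((hy x).1 le_rfl))]

theorem C_disjoint {x y : BraidGroup n} (h : x ≠ y) : Disjoint (C x) (C y) := by
  refine Set.disjoint_left.2 fun v hx hy => h ?_
  obtain ⟨A, hA, rfl, hvA⟩ := mem_C_iff.1 hx
  obtain ⟨B, hB, rfl, hvB⟩ := mem_C_iff.1 hy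
  obtain rfl := eq_of_mem_WA hvA hvB
  rfl

theorem realRep_mem_C {q : ℝ} (hq0 : 0 < q) (hq1 : q < 1) {x y : BraidGroup n}
    (hx : x ∈ positiveBraids n) (hy : y ∈ positiveBraids n) {v : V n (LaurentPolynomial ℝ)}
    (hv : v ∈ C y) : realRep n q hq0 x v ∈ C (LF ⟨x * y, mul_mem hx hy⟩) := by
  obtain ⟨w, rfl⟩ := exists_braid_eq hx
  obtain ⟨A, hA, hAy, hvA⟩ := mem_C_iff.1 hv
  obtain ⟨z, hz, e⟩ := exists_GB_eq hA
  obtain ⟨u, hu, rfl⟩ := exists_reduced z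
  rw [e, permBraid_eq_braid hu rfl] at hAy
  -- `A` may exceed its greatest inversion set, but only the inversion sets inside it matter, and
  -- `starWord w` respects this equivalence.
  have hAu : SameL A (starWord u ∅) := by rwa [starWord_empty_of_reduced hu]
  have hu' := starWord_isHalfPermutation u (isHalfPermutation_empty (n := n))
  refine mem_C_iff.2 ⟨_, starWord_isHalfPermutation w hA, ?_, realRep_braid_mem_WA hq0 hq1 w hvA⟩
  rw [LF_eq_GB (w := w ++ u) (by rw [braid_append, hAy])]
  refine SameL.GB_eq ?_ _ _
  rw [starWord_append]
  exact hAu.starWord hA hu' w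

/-! ### Faithfulness -/

theorem has_starWord_cons (k : Fin (n - 1)) (w : List (Fin (n - 1))) (A : Set (Ref n)) :
    Has (starWord (k :: w) A) k (k + 1) := by
  rw [starWord_cons, has_star]
  refine ⟨by omega, by omega, ?_⟩
  simp

theorem braid_eq_of_realRep_eq {q : ℝ} (hq0 : 0 < q) (hq1 : q < 1) {v w : List (Fin (n - 1))}
    (h : realRep n q hq0 (braid v) = realRep n q hq0 (braid w)) : braid v = braid w := by
  induction v generalizing w with
  | nil =>
    rcases w with _ | ⟨k, w⟩
    · rfl
    · have hk := has_starWord_cons k w ∅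
      rw [← starWord_eq_of_realRep_eq hq0 hq1 h] at hk
      exact hk.2.2.elim
  | cons k v ih =>
    -- Divisibility by `sigma k` is visible in the set of pairs, so it passes from `braid (k :: v)`
    -- to `braid w`, and the letter can be cancelled.
    have hk : L (simpleSwap k) ⊆ starWord (k :: v) ∅ :=
      (exists_eq_permBraid_mul_iff _ _).1 ⟨_, braid_mem_positiveBraids v, by
        rw [permBraid_simpleSwap, braid_cons]⟩
    rw [starWord_eq_of_realRep_eq hq0 hq1 h, ← exists_eq_permBraid_mul_iff] at hk
    obtain ⟨p, hp, e⟩ := hk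
    obtain ⟨u, rfl⟩ := exists_braid_eq hp
    rw [permBraid_simpleSwap] at e
    rw [braid_cons, e, map_mul, map_mul, mul_right_inj] at h
    rw [braid_cons, e, ih h]

theorem realRep_injective {q : ℝ} (hq0 : 0 < q) (hq1 : q < 1) :
    Function.Injective (realRep n q hq0) := by
  refine (injective_iff_map_eq_one _).2 fun b hb => ?_
  obtain ⟨x, hx, y, hy, rfl⟩ := exists_eq_mul_inv b
  obtain ⟨v, rfl⟩ := exists_braid_eq hx
  obtain ⟨w, rfl⟩ := exists_braid_eq hy
  rw [map_mul, map_inv, mul_inv_eq_one] at hb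
  rw [mul_inv_eq_one]
  exact braid_eq_of_realRep_eq hq0 hq1 hb

end Krammer

theorem lemma3p7 (n : ℕ) (hn : 1 ≤ n) (q : ℝ) (hq0 : 0 < q) (hq1 : q < 1) :
    (∀ x ∈ Krammer.Omega n, (Krammer.C x).Nonempty) ∧
    (∀ x ∈ Krammer.Omega n, ∀ y ∈ Krammer.Omega n, x ≠ y → Disjoint (Krammer.C x) (Krammer.C y)) ∧
    (∀ (x : Krammer.BraidGroup n) (hx : x ∈ Krammer.Omega n)
        (y : Krammer.BraidGroup n) (hy : y ∈ Krammer.Omega n),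
      Krammer.realRep n q hq0 x '' Krammer.C y ⊆
        Krammer.C (Krammer.LF ⟨x * y, mul_mem (Krammer.Omega_subset hx) (Krammer.Omega_subset hy)⟩)) ∧
    Function.Injective (Krammer.realRep n q hq0) := by
  refine ⟨fun x hx => Krammer.C_nonempty hx, fun x _ y _ h => Krammer.C_disjoint h, ?_,
    Krammer.realRep_injective hq0 hq1⟩
  rintro x hx y hy _ ⟨v, hv, rfl⟩
  exact Krammer.realRep_mem_C hq0 hq1 (Krammer.Omega_subset hx) (Krammer.Omega_subset hy) hv
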